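/- Consider the discrete-time plant $x[t+1]=Ax[t]+B_1w[t]+B_2u[t]$, $z[t]=C_1x[t]+D_{11}w[t]+D_{12}u[t]$, $y[t]=C_2x[t]+D_{21}w[t]+D_{22}u[t]$ with real matrices, $(A,B_2)$ stabilizable, $(A,C_2)$ detectable and $D_{22}=0$; put $\mathbf P_{ij}=C_i(zI-A)^{-1}B_j+D_{ij}$. Let $\mathcal C_{\rm stab}$ be the set of transfer matrices $\mathbf K$ with a stabilizable and detectable realization $(A_k,B_k,C_k,D_k)$ whose interconnection $\mathbf u=\mathbf K\mathbf y$ with the plant is internally stable: it is well-posed ($I-D_{22}D_k$ is invertible), and for $w=0$ the states of plant and controller tend to $0$ from all initial states. Let $\mathcal{RH}_\infty$ be the set of proper stable real-rational transfer matrices, let $\frac1z\mathcal{RH}_\infty$ be the subset of strictly proper ones, and put $f(\mathbf P,\mathbf K)=\mathbf P_{11}+\mathbf P_{12}\mathbf K(I-\mathbf P_{22}\mathbf K)^{-1}\mathbf P_{21}$. The system-level (SLP) affine subspace is the set of $(\mathbf R,\mathbf M,\mathbf N,\mathbf L)$ with $$\begin{bmatrix}zI-A&-B_2\end{bmatrix}\begin{bmatrix}\mathbf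 R&\mathbf N\\\mathbf M&\mathbf L\end{bmatrix}=\begin{bmatrix}I&0\end{bmatrix},\quad \begin{bmatrix}\mathbf R&\mathbf N\\\mathbf M&\mathbf L\end{bmatrix}\begin{bmatrix}zI-A\\-C_2\end{bmatrix}=\begin{bmatrix}I\\0\end{bmatrix},\quad \mathbf R,\mathbf M,\mathbf N\in\tfrac1z\mathcal{RH}_\infty,\ \mathbf L\in\mathcal{RH}_\infty .$$ Let $\mathcal L$ be a real-linear subspace of the real-rational transfer matrices of the size of $\mathbf K$ which is closed, in the sense that its proper part is closed among the proper transfer matrices under convergence of each impulse response coefficient (for a linear subspace, equivalently: a proper $\mathbf K$ whose impulse response agrees on every finite horizon with that of some element of $\mathcal L$ is in $\mathcal L$). Suppose that $\mathcal L$ is quadratically invariant under $\mathbf P_{22}$, i.e. $\mathbf K\mathbf P_{22}\mathbf K\in\mathcal L$ for all $\mathbf K\in\mathcal L$. Then: 1. $\mathcal C_{\rm stab}\cap\mathcal L=\{\mathbf K=\mathbf L-\mathbf M\mathbf R^{-1}\mathbf N \mid (\mathbf R,\mathbf M,\mathbf N,\mathbf L)\text{ in the SLP affine subspace},\ \mathbf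 L\in\mathcal L\}$. Here $\mathbf R$ is invertible for every point of the SLP affine subspace, and $I-\mathbf P_{22}\mathbf K$ is invertible for every $\mathbf K\in\mathcal C_{\rm stab}$. 2. For every norm (more generally, every seminorm) $\|\cdot\|$ on the $\mathcal{RH}_\infty$ matrices of the size of $f(\mathbf P,\mathbf K)$, the distributed optimal control problem $\min_{\mathbf K}\|f(\mathbf P,\mathbf K)\|$ subject to $\mathbf K\in\mathcal C_{\rm stab}\cap\mathcal L$ is equivalent to the problem $$\min_{\mathbf R,\mathbf M,\mathbf N,\mathbf L}\left\|\begin{bmatrix}C_1&D_{12}\end{bmatrix}\begin{bmatrix}\mathbf R&\mathbf N\\\mathbf M&\mathbf L\end{bmatrix}\begin{bmatrix}B_1\\D_{21}\end{bmatrix}+D_{11}\right\|\quad\text{subject to }(\mathbf R,\mathbf M,\mathbf N,\mathbf L)\text{ in the SLP affine subspace},\ \mathbf L\in\mathcal L,$$ and the latter is convex (convex feasible set, convex objective). That is, $(\mathbf R,\mathbf M,\mathbf N,\mathbf L)\mapsto\mathbf L-\mathbf M\mathbf R^{-1}\mathbf N$ is a bijection from the feasible points of the second problem to those of the first, the transfer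 matrices inside the norms agree under it and lie in $\mathcal{RH}_\infty$, and hence the optimal values agree and minimizers correspond to minimizers. -/

import Mathlib

noncomputable section

open Filter Topology

namespace OutputFeedback

/-! ### Real-rational transfer functions and matrices in the variable `z = RatFunc.X` -/

/-- A rational function is proper if it is bounded at infinity. -/
def IsProper (f : RatFunc ℝ) : Prop := f.num.degree ≤ f.denom.degree

/-- A rational function is strictly proper if it vanishes at infinity. -/
def IsStrictlyProper (f : RatFunc ℝ) : Prop := f.num.degree < f.denom.degree

/-- A (discrete-time) rational function is stable if all its poles lie in the open unit disc. -/
def IsStable (f : RatFunc ℝ) : Prop :=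
  ∀ s : ℂ, Polynomial.aeval s f.denom = 0 → ‖s‖ < 1

/-- `TF p m`: real-rational transfer matrices of size `p × m`. -/
abbrev TF (p m : ℕ) : Type := Matrix (Fin p) (Fin m) (RatFunc ℝ)

/-- The set of proper stable real-rational transfer matrices. -/
def RHinf (p m : ℕ) : Set (TF p m) :=
  {G | ∀ i j, IsProper (G i j) ∧ IsStable (G i j)}

/-- The set `(1/z) RH∞` of strictly proper stable real-rational transfer matrices. -/
def sRHinf (p m : ℕ) : Set (TF p m) :=
  {G | ∀ i j, IsStrictlyProper (G i j) ∧ IsStable (G i j)}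

/-- A real matrix seen as a constant transfer matrix. -/
def const {p m : ℕ} (A : Matrix (Fin p) (Fin m) ℝ) : TF p m := A.map RatFunc.C

/-- `zI - A`. -/
def zIsub {n : ℕ} (A : Matrix (Fin n) (Fin n) ℝ) : TF n n :=
  (RatFunc.X : RatFunc ℝ) • (1 : TF n n) - const A

/-- The transfer matrix `C (zI - A)⁻¹ B + D` of a state-space realization. -/
def transfer {n p m : ℕ} (A : Matrix (Fin n) (Fin n) ℝ) (B : Matrix (Fin n) (Fin m) ℝ)
    (C : Matrix (Fin p) (Fin n) ℝ) (D : Matrix (Fin p) (Fin m) ℝ) : TF p m :=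
  const C * (zIsub A)⁻¹ * const B + const D

/-! ### State-space systems -/

/-- All eigenvalues of the real matrix `A` lie in the open unit disc. -/
def IsSchur {n : ℕ} (A : Matrix (Fin n) (Fin n) ℝ) : Prop :=
  ∀ s ∈ spectrum ℂ (A.map (algebraMap ℝ ℂ)), ‖s‖ < 1

/-- The pair `(A, B)` is stabilizable. -/
def IsStabilizable {n m : ℕ} (A : Matrix (Fin n) (Fin n) ℝ) (B : Matrix (Fin n) (Fin m) ℝ) :
    Prop :=
  ∃ F : Matrix (Fin m) (Fin n) ℝ, IsSchur (A + B * F)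

/-- The pair `(A, C)` is detectable. -/
def IsDetectable {n p : ℕ} (A : Matrix (Fin n) (Fin n) ℝ) (C : Matrix (Fin p) (Fin n) ℝ) :
    Prop :=
  ∃ H : Matrix (Fin n) (Fin p) ℝ, IsSchur (A + H * C)

/-- The plant `x⁺ = A x + B₁ w + B₂ u`, `z = C₁ x + D₁₁ w + D₁₂ u`, `y = C₂ x + D₂₁ w + D₂₂ u`;
the dimensions are those of `x`, `w`, `u`, `z`, `y`. -/
structure Plant (n nw nu nz ny : ℕ) where
  A : Matrix (Fin n) (Fin n) ℝ
  B1 : Matrix (Fin n) (Fin nw) ℝ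
  B2 : Matrix (Fin n) (Fin nu) ℝ
  C1 : Matrix (Fin nz) (Fin n) ℝ
  C2 : Matrix (Fin ny) (Fin n) ℝ
  D11 : Matrix (Fin nz) (Fin nw) ℝ
  D12 : Matrix (Fin nz) (Fin nu) ℝ
  D21 : Matrix (Fin ny) (Fin nw) ℝ
  D22 : Matrix (Fin ny) (Fin nu) ℝ

/-- A controller realization `ξ⁺ = A ξ + B y`, `u = C ξ + D y`. -/
structure Controller (k nu ny : ℕ) where
  A : Matrix (Fin k) (Fin k) ℝ
  B : Matrix (Fin k) (Fin ny) ℝ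
  C : Matrix (Fin nu) (Fin k) ℝ
  D : Matrix (Fin nu) (Fin ny) ℝ

/-- The transfer matrix of a controller realization. -/
def Controller.tf {k nu ny : ℕ} (κ : Controller k nu ny) : TF nu ny :=
  transfer κ.A κ.B κ.C κ.D

namespace Plant

variable {n nw nu nz ny : ℕ} (P : Plant n nw nu nz ny)

def P11 : TF nz nw := transfer P.A P.B1 P.C1 P.D11
def P12 : TF nz nu := transfer P.A P.B2 P.C1 P.D12
def P21 : TF ny nw := transfer P.A P.B1 P.C2 P.D21
def P22 : TF ny nu := transfer P.A P.B2 P.C2 P.D22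

/-- The signals `x, ξ, w, u, y` satisfy the equations of the interconnection of the plant
and the controller. -/
def IsTrajectory {k : ℕ} (κ : Controller k nu ny)
    (x : ℕ → Fin n → ℝ) (ξ : ℕ → Fin k → ℝ) (w : ℕ → Fin nw → ℝ)
    (u : ℕ → Fin nu → ℝ) (y : ℕ → Fin ny → ℝ) : Prop :=
  ∀ t : ℕ,
    x (t + 1) = P.A.mulVec (x t) + P.B1.mulVec (w t) + P.B2.mulVec (u t) ∧
    y t = P.C2.mulVec (x t) + P.D21.mulVec (w t) + P.D22.mulVec (u t) ∧
    ξ (t + 1) = κ.A.mulVec (ξ t) + κ.B.mulVec (y t) ∧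
    u t = κ.C.mulVec (ξ t) + κ.D.mulVec (y t)

/-- Internal stability: the interconnection is well-posed, and for zero disturbance the states
of plant and controller converge to zero from all initial states. -/
def InternallyStable {k : ℕ} (κ : Controller k nu ny) : Prop :=
  IsUnit (1 - P.D22 * κ.D) ∧
  ∀ x ξ u y, P.IsTrajectory κ x ξ (fun _ => 0) u y →
    Tendsto x atTop (𝓝 0) ∧ Tendsto ξ atTop (𝓝 0)

/-- The set of internally stabilizing controllers: transfer matrices `K` having a stabilizable
and detectable realization whose interconnection with the plant is internally stable. -/
def Cstab : Set (TF nu ny) :=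
  {K | ∃ (k : ℕ) (κ : Controller k nu ny),
    IsStabilizable κ.A κ.B ∧ IsDetectable κ.A κ.C ∧ κ.tf = K ∧ P.InternallyStable κ}

/-- The closed-loop transfer matrix from `w` to `z`:
`f(P, K) = P₁₁ + P₁₂ K (I - P₂₂ K)⁻¹ P₂₁`. -/
def closedLoop (K : TF nu ny) : TF nz nw :=
  P.P11 + P.P12 * K * (1 - P.P22 * K)⁻¹ * P.P21

end Plant

/-! ### The system-level parameterization -/

/-- Quadruples `(R, M, N, L)` of transfer matrices. -/
abbrev SLParam (n nu ny : ℕ) : Type := TF n n × TF nu n × TF n ny × TF nu ny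

namespace SLParam

variable {n nu ny : ℕ} (θ : SLParam n nu ny)

def R : TF n n := θ.1
def M : TF nu n := θ.2.1
def N : TF n ny := θ.2.2.1
def L : TF nu ny := θ.2.2.2

/-- The block matrix `[R N; M L]`. -/
def block : Matrix (Fin n ⊕ Fin nu) (Fin n ⊕ Fin ny) (RatFunc ℝ) :=
  Matrix.fromBlocks (R θ) (N θ) (M θ) (L θ)

/-- The controller `K = L - M R⁻¹ N`. -/
def controller : TF nu ny := L θ - M θ * (R θ)⁻¹ * N θ

end SLParam

namespace Plant

variable {n nw nu nz ny : ℕ} (P : Plant n nw nu nz ny)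

/-- The affine subspace of achievable system responses. -/
def slp : Set (SLParam n nu ny) :=
  {θ | Matrix.fromCols (zIsub P.A) (-const P.B2) * SLParam.block θ = Matrix.fromCols 1 0 ∧
    SLParam.block θ * Matrix.fromRows (zIsub P.A) (-const P.C2) = Matrix.fromRows 1 0 ∧
    SLParam.R θ ∈ sRHinf n n ∧ SLParam.M θ ∈ sRHinf nu n ∧ SLParam.N θ ∈ sRHinf n ny ∧
    SLParam.L θ ∈ RHinf nu ny}

/-- The system responses in the affine subspace with `L` in the subspace `S`. -/
def slpIn (S : Submodule ℝ (TF nu ny)) : Set (SLParam n nu ny) :=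
  {θ | θ ∈ P.slp ∧ SLParam.L θ ∈ S}

/-- `[C₁ D₁₂] [R N; M L] [B₁; D₂₁] + D₁₁`. -/
def slpResponse (θ : SLParam n nu ny) : TF nz nw :=
  Matrix.fromCols (const P.C1) (const P.D12) * SLParam.block θ *
    Matrix.fromRows (const P.B1) (const P.D21) + const P.D11

end Plant

/-! ### Subspace constraints and performance measures -/

/-- `S` is quadratically invariant under `G`. -/
def QuadInvariant {nu ny : ℕ} (S : Submodule ℝ (TF nu ny)) (G : TF ny nu) : Prop :=
  ∀ K ∈ S, K * G * K ∈ S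

/-- The proper part of the subspace `S` is closed, among the proper transfer matrices, for
convergence of impulse responses on finite time horizons: a proper `K` whose impulse response
`K₀, K₁, K₂, …` (`K = ∑ Kₜ z⁻ᵗ`) agrees on every horizon `0, …, T - 1` with that of an element of
`S` belongs to `S`. The impulse responses agree there iff `z ^ T (K - K')` is proper.
(For a linear `S` exact agreement and approximation on finite horizons give the same closure,
as the truncations of elements of `S` form a subspace of a finite-dimensional space.) -/
def IsClosedSubspace {nu ny : ℕ} (S : Submodule ℝ (TF nu ny)) : Prop :=
  ∀ K : TF nu ny, (∀ i j, IsProper (K i j)) →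
    (∀ T : ℕ, ∃ K' ∈ S, ∀ i j, IsProper (RatFunc.X ^ T * (K i j - K' i j))) → K ∈ S

/-- `ν` restricts to a seminorm on `RH∞` (as the `H₂` and `H∞` norms do). -/
def IsSeminormOnRHinf {p m : ℕ} (ν : TF p m → ℝ) : Prop :=
  (∀ G ∈ RHinf p m, ∀ H ∈ RHinf p m, ν (G + H) ≤ ν G + ν H) ∧
  (∀ (c : ℝ), ∀ G ∈ RHinf p m, ν (c • G) = |c| * ν G)

end OutputFeedback

end

noncomputable section

open Filter Topology

namespace OutputFeedback

/-! Write `K` for `L - M R⁻¹ N` and `G` for `P₂₂`. The SLP equations say that `R, M, N, L` are the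
closed-loop responses of state and input to state disturbance and measurement noise under `u = K y`.
They give `R = (zI - A - B₂ K C₂)⁻¹`, `N = R B₂ K`, `M = K C₂ R` and `L = K + K C₂ N`, so `K`
determines all four (`controller_injOn`). Since `N = (zI - A)⁻¹ B₂ L`, the last one becomes `L = K +
K G L`, that is `L = K (I - G K)⁻¹` (`controller_feedback`). Hence `f(P, K) = P₁₁ + P₁₂ L P₂₁`,
which expands to the affine SLP objective.

Without the constraint on `L`, the image of the SLP subspace is exactly the set of stabilizing
controllers. Given a stabilizing realization, the responses are read off the resolvent of the
closed-loop state matrix, which is Schur (`exists_slp_of_mem_Cstab`). Conversely, given a system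
response, a stabilizing realization of `K` is an observer-based controller with a stable system `Q`
acting on the innovation (the Youla parametrization), where `Q` is an explicit stable combination of
`R, M, N, L` (`controller_mem_Cstab`).

Quadratic invariance gives `K ∈ S ↔ L ∈ S` (`controller_mem_iff`). By polarization `(K G)ᵗ K ∈ S`
for all `t`, and the Neumann series of `L` converges on finite horizons because `K G` is strictly
proper; the closedness of `S` then gives `L ∈ S`. The converse is the same argument for `K = L + L
(-G) K`.

All inverses exist because `I - E` is invertible for every strictly proper `E`. This and properness
are handled through the valuation of `ℝ(z)` at infinity, where proper means valuation at most `1`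
and strictly proper means less than `1`. -/

/-! ### Properness as a valuation condition, stability as a subring. -/

/-- The valuation of `ℝ(z)` at `z = ∞`. -/
def valInfty : Valuation (RatFunc ℝ) (WithZero (Multiplicative ℤ)) :=
  @RatFunc.inftyValuation ℝ _ (Classical.decEq _)

theorem valInfty_X : valInfty RatFunc.X = WithZero.exp 1 :=
  @RatFunc.inftyValuation.X ℝ _ (Classical.decEq _)

theorem valInfty_C_le (c : ℝ) : valInfty (RatFunc.C c) ≤ 1 := by
  by_cases hc : c = 0
  · simp [hc]
  · exact (@RatFunc.inftyValuation.C ℝ _ (Classical.decEq _) c hc).le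

theorem valInfty_of_ne_zero {f : RatFunc ℝ} (hf : f ≠ 0) :
    valInfty f = WithZero.exp ((f.num.natDegree : ℤ) - f.denom.natDegree) := by
  classical
  unfold valInfty
  rw [RatFunc.inftyValuation_apply]
  exact @RatFunc.inftyValuation_of_nonzero ℝ _ (Classical.decEq _) f hf

theorem isProper_iff {f : RatFunc ℝ} : IsProper f ↔ valInfty f ≤ 1 := by
  by_cases hf : f = 0
  · simp [hf, IsProper]
  · rw [valInfty_of_ne_zero hf, IsProper, Polynomial.degree_eq_natDegree (RatFunc.num_ne_zero hf),
      Polynomial.degree_eq_natDegree f.denom_ne_zero, ← WithZero.exp_zero, WithZero.exp_le_exp,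
      Nat.cast_le]
    omega

theorem isStrictlyProper_iff {f : RatFunc ℝ} : IsStrictlyProper f ↔ valInfty f < 1 := by
  by_cases hf : f = 0
  · simp [hf, IsStrictlyProper]
  · rw [valInfty_of_ne_zero hf, IsStrictlyProper,
      Polynomial.degree_eq_natDegree (RatFunc.num_ne_zero hf),
      Polynomial.degree_eq_natDegree f.denom_ne_zero, ← WithZero.exp_zero, WithZero.exp_lt_exp,
      Nat.cast_lt]
    omega

theorem isStable_of_denom_dvd {f : RatFunc ℝ} {p : Polynomial ℝ} (h : f.denom ∣ p)
    (hp : ∀ s : ℂ, Polynomial.aeval s p = 0 → ‖s‖ < 1) : IsStable f := by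
  intro s hs
  obtain ⟨q, rfl⟩ := h
  exact hp s (by rw [map_mul, hs, zero_mul])

/-- The subring of stable rational functions. -/
def stableSubring : Subring (RatFunc ℝ) where
  carrier := {f | IsStable f}
  zero_mem' := by intro s hs; simp at hs
  one_mem' := by intro s hs; simp at hs
  add_mem' := by
    intro f g hf hg
    refine isStable_of_denom_dvd (RatFunc.denom_add_dvd f g) fun s hs => ?_
    rw [map_mul, mul_eq_zero] at hs
    exact hs.elim (hf s) (hg s)
  mul_mem' := by
    intro f g hf hg
    refine isStable_of_denom_dvd (RatFunc.denom_mul_dvd f g) fun s hs => ?_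
    rw [map_mul, mul_eq_zero] at hs
    exact hs.elim (hf s) (hg s)
  neg_mem' := by
    intro f hf
    have h : IsStable (RatFunc.C (-1) * f) := by
      refine isStable_of_denom_dvd (RatFunc.denom_mul_dvd _ f) fun s hs => ?_
      rw [RatFunc.denom_C, one_mul] at hs
      exact hf s hs
    simpa using h

theorem mem_stableSubring {f : RatFunc ℝ} : f ∈ stableSubring ↔ IsStable f := Iff.rfl

theorem C_mem_stableSubring (c : ℝ) : RatFunc.C c ∈ stableSubring := by
  intro s hs; simp at hs

/-! ### Proper, strictly proper and stable matrices; invertibility of `I - E`. -/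

section Matrices

variable {ι κ μ : Type*}

/-- All entries of the transfer matrix lie in the subring `T`. -/
def EntriesIn (T : Subring (RatFunc ℝ)) (G : Matrix ι κ (RatFunc ℝ)) : Prop := ∀ i j, G i j ∈ T

/-- All entries of the transfer matrix are strictly proper. -/
def EntriesStrict (G : Matrix ι κ (RatFunc ℝ)) : Prop := ∀ i j, valInfty (G i j) < 1

/-- All entries of the transfer matrix are proper. -/
abbrev EntriesProper (G : Matrix ι κ (RatFunc ℝ)) : Prop := EntriesIn valInfty.integer G

/-- All entries of the transfer matrix are stable. -/
abbrev EntriesStable (G : Matrix ι κ (RatFunc ℝ)) : Prop := EntriesIn stableSubring G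

variable {T : Subring (RatFunc ℝ)}

namespace EntriesIn

theorem mul [Fintype κ] {G : Matrix ι κ (RatFunc ℝ)} {H : Matrix κ μ (RatFunc ℝ)}
    (hG : EntriesIn T G) (hH : EntriesIn T H) : EntriesIn T (G * H) := fun i j => by
  rw [Matrix.mul_apply]
  exact T.sum_mem fun k _ => T.mul_mem (hG i k) (hH k j)

theorem add {G H : Matrix ι κ (RatFunc ℝ)} (hG : EntriesIn T G) (hH : EntriesIn T H) :
    EntriesIn T (G + H) := fun i j => T.add_mem (hG i j) (hH i j)

theorem neg {G : Matrix ι κ (RatFunc ℝ)} (hG : EntriesIn T G) :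
    EntriesIn T (-G) := fun i j => T.neg_mem (hG i j)

theorem sub {G H : Matrix ι κ (RatFunc ℝ)} (hG : EntriesIn T G) (hH : EntriesIn T H) :
    EntriesIn T (G - H) := fun i j => T.sub_mem (hG i j) (hH i j)

theorem one [DecidableEq ι] : EntriesIn T (1 : Matrix ι ι (RatFunc ℝ)) := fun i j => by
  rw [Matrix.one_apply]
  split_ifs
  exacts [T.one_mem, T.zero_mem]

end EntriesIn

theorem entriesStable_map_C (A : Matrix ι κ ℝ) : EntriesStable (A.map RatFunc.C) :=
  fun i j => C_mem_stableSubring (A i j)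

theorem entriesProper_map_C (A : Matrix ι κ ℝ) : EntriesProper (A.map RatFunc.C) :=
  fun i j => valInfty_C_le (A i j)

namespace EntriesStrict

theorem entriesProper {G : Matrix ι κ (RatFunc ℝ)} (hG : EntriesStrict G) : EntriesProper G :=
  fun i j => (hG i j).le

theorem add {G H : Matrix ι κ (RatFunc ℝ)} (hG : EntriesStrict G) (hH : EntriesStrict H) :
    EntriesStrict (G + H) := fun i j => Valuation.map_add_lt _ (hG i j) (hH i j)

theorem neg {G : Matrix ι κ (RatFunc ℝ)} (hG : EntriesStrict G) : EntriesStrict (-G) :=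
  fun i j => by simpa using hG i j

theorem mul_left [Fintype κ] {G : Matrix ι κ (RatFunc ℝ)} {H : Matrix κ μ (RatFunc ℝ)}
    (hG : EntriesProper G) (hH : EntriesStrict H) : EntriesStrict (G * H) := fun i j => by
  rw [Matrix.mul_apply]
  refine Valuation.map_sum_lt _ one_ne_zero fun k _ => ?_
  rw [map_mul]
  exact (mul_le_of_le_one_left' (hG i k)).trans_lt (hH k j)

theorem mul_right [Fintype κ] {G : Matrix ι κ (RatFunc ℝ)} {H : Matrix κ μ (RatFunc ℝ)}
    (hG : EntriesStrict G) (hH : EntriesProper H) : EntriesStrict (G * H) := fun i j => by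
  rw [Matrix.mul_apply]
  refine Valuation.map_sum_lt _ one_ne_zero fun k _ => ?_
  rw [map_mul]
  exact (mul_le_of_le_one_right' (hH k j)).trans_lt (hG i k)

end EntriesStrict

theorem mem_RHinf_iff {p m : ℕ} {G : TF p m} :
    G ∈ RHinf p m ↔ EntriesProper G ∧ EntriesStable G := by
  simp only [RHinf, Set.mem_ofPred_eq, EntriesProper, EntriesStable, EntriesIn, ← forall_and,
    Valuation.mem_integer_iff, mem_stableSubring, isProper_iff]

theorem mem_sRHinf_iff {p m : ℕ} {G : TF p m} :
    G ∈ sRHinf p m ↔ EntriesStrict G ∧ EntriesStable G := by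
  simp only [sRHinf, Set.mem_ofPred_eq, EntriesStrict, EntriesStable, EntriesIn, ← forall_and,
    mem_stableSubring, isStrictlyProper_iff]

/-- A solution of `x = b + E x` with `E` strictly proper and `b` proper is proper. -/
theorem valInfty_le_one_of_eq_add_mulVec [Fintype ι] {E : Matrix ι ι (RatFunc ℝ)}
    (hE : EntriesStrict E) {b x : ι → RatFunc ℝ} (hb : ∀ i, valInfty (b i) ≤ 1)
    (hx : x = b + E.mulVec x) (i : ι) : valInfty (x i) ≤ 1 := by
  -- Look at an entry `x k` of largest valuation. If it exceeded `1`, then `b k` and every `E k j *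
  -- x j` would have smaller valuation than `x k`, contradicting the ultrametric inequality.
  obtain ⟨k, -, hk⟩ := Finset.exists_max_image Finset.univ (fun i => valInfty (x i))
    ⟨i, Finset.mem_univ i⟩
  refine (hk i (Finset.mem_univ i)).trans ?_
  by_contra! h
  have h0 : valInfty (x k) ≠ 0 := (zero_lt_one.trans h).ne'
  have h1 : valInfty (x k) < valInfty (x k) := by
    conv_lhs => rw [hx]
    refine Valuation.map_add_lt _ ((hb k).trans_lt h) ?_
    refine Valuation.map_sum_lt _ h0 fun j _ => ?_
    rw [map_mul]
    calc valInfty (E k j) * valInfty (x j) ≤ valInfty (E k j) * valInfty (x k) := by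
          gcongr
          exact hk j (Finset.mem_univ j)
      _ < 1 * valInfty (x k) := by
          exact mul_lt_mul_of_pos_right (hE k j) (zero_lt_one.trans h)
      _ = _ := one_mul _
  exact lt_irrefl _ h1

theorem entriesProper_of_eq_add_mul [Fintype ι] {E : Matrix ι ι (RatFunc ℝ)}
    (hE : EntriesStrict E) {B G : Matrix ι κ (RatFunc ℝ)} (hB : EntriesProper B)
    (hG : G = B + E * G) : EntriesProper G := fun i j =>
  valInfty_le_one_of_eq_add_mulVec hE (b := B.col j) (x := G.col j) (fun i => hB i j)
    (by
      funext k
      have := congrFun (congrFun hG k) j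
      simpa [Matrix.mul_apply, Matrix.mulVec, dotProduct] using this) i

theorem isUnit_one_sub_of_entriesStrict [Fintype ι] [DecidableEq ι] {E : Matrix ι ι (RatFunc ℝ)}
    (hE : EntriesStrict E) : IsUnit (1 - E) := by
  rw [← Matrix.mulVec_injective_iff_isUnit]
  refine (injective_iff_map_eq_zero (Matrix.mulVecLin (1 - E))).2 fun x hx => ?_
  rw [Matrix.mulVecLin_apply, Matrix.sub_mulVec, Matrix.one_mulVec, sub_eq_zero] at hx
  funext i
  by_contra hi
  -- A kernel vector may be rescaled by any rational function; here its `i`-th entry is made equal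
  -- to `z`, which is not proper.
  have h := valInfty_le_one_of_eq_add_mulVec hE (b := 0)
    (x := (RatFunc.X * (x i)⁻¹) • x) (by simp)
    (by rw [Matrix.mulVec_smul, ← hx, zero_add]) i
  have hi' : x i ≠ 0 := hi
  rw [Pi.smul_apply, smul_eq_mul, mul_assoc, inv_mul_cancel₀ hi', mul_one, valInfty_X,
    ← WithZero.exp_zero, WithZero.exp_le_exp] at h
  omega

/-! ### The resolvent `(zI - A)⁻¹`. -/

/-- The matrix `zI - A`, for an arbitrary finite index type. -/
def charTF [DecidableEq ι] (A : Matrix ι ι ℝ) : Matrix ι ι (RatFunc ℝ) :=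
  (RatFunc.X : RatFunc ℝ) • (1 : Matrix ι ι (RatFunc ℝ)) - A.map RatFunc.C

theorem entriesStrict_X_inv_smul {G : Matrix ι κ (RatFunc ℝ)} (hG : EntriesProper G) :
    EntriesStrict ((RatFunc.X : RatFunc ℝ)⁻¹ • G) := fun i j => by
  rw [Matrix.smul_apply, smul_eq_mul, map_mul, map_inv₀, valInfty_X]
  refine (mul_le_of_le_one_right' (hG i j)).trans_lt ?_
  rw [← WithZero.exp_neg, ← WithZero.exp_zero, WithZero.exp_lt_exp]
  omega

variable [Fintype ι] [DecidableEq ι]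

theorem charTF_eq_map_charmatrix (A : Matrix ι ι ℝ) :
    charTF A = A.charmatrix.map (algebraMap (Polynomial ℝ) (RatFunc ℝ)) := by
  ext i j
  by_cases h : i = j
  · subst h; simp [charTF, RatFunc.algebraMap_C]
  · simp [charTF, h, RatFunc.algebraMap_C]

theorem det_charTF (A : Matrix ι ι ℝ) :
    (charTF A).det = algebraMap (Polynomial ℝ) (RatFunc ℝ) A.charpoly := by
  rw [charTF_eq_map_charmatrix, Matrix.charpoly, RingHom.map_det]; rfl

theorem isUnit_det_charTF (A : Matrix ι ι ℝ) : IsUnit (charTF A).det := by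
  rw [det_charTF, isUnit_iff_ne_zero]
  simpa using A.charpoly_monic.ne_zero

/-- The identity `(zI - A)⁻¹ = z⁻¹ (I + A (zI - A)⁻¹)` is used twice: as a fixed-point equation with
strictly proper coefficient it gives properness, and then its factor `z⁻¹` gives strictness. -/
theorem entriesStrict_inv_charTF (A : Matrix ι ι ℝ) : EntriesStrict (charTF A)⁻¹ := by
  have hX : (RatFunc.X : RatFunc ℝ) ≠ 0 := RatFunc.X_ne_zero
  have h : (charTF A)⁻¹ = (RatFunc.X : RatFunc ℝ)⁻¹ • (1 + A.map RatFunc.C * (charTF A)⁻¹) := by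
    have := Matrix.mul_nonsing_inv _ (isUnit_det_charTF A)
    conv at this => lhs; lhs; rw [charTF]
    rw [sub_mul, Matrix.smul_mul, one_mul, sub_eq_iff_eq_add] at this
    rw [← this, smul_smul, inv_mul_cancel₀ hX, one_smul]
  have hp : EntriesProper (charTF A)⁻¹ := by
    refine entriesProper_of_eq_add_mul (E := (RatFunc.X : RatFunc ℝ)⁻¹ • A.map RatFunc.C)
      (B := (RatFunc.X : RatFunc ℝ)⁻¹ • 1) (entriesStrict_X_inv_smul (entriesProper_map_C A))
      (entriesStrict_X_inv_smul EntriesIn.one).entriesProper ?_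
    conv_lhs => rw [h]
    rw [smul_add, Matrix.smul_mul]
  rw [h]
  exact entriesStrict_X_inv_smul (EntriesIn.one.add ((entriesProper_map_C A).mul hp))

/-- By Cramer's rule every entry of the resolvent is a polynomial divided by the characteristic
polynomial. -/
theorem entriesStable_inv_charTF {A : Matrix ι ι ℝ}
    (hA : ∀ s : ℂ, Polynomial.aeval s A.charpoly = 0 → ‖s‖ < 1) :
    EntriesStable (charTF A)⁻¹ := fun i j => by
  refine isStable_of_denom_dvd (p := A.charpoly) ?_ hA
  have : (charTF A)⁻¹ i j = algebraMap (Polynomial ℝ) (RatFunc ℝ) (A.charmatrix.adjugate i j) /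
      algebraMap (Polynomial ℝ) (RatFunc ℝ) A.charpoly := by
    rw [Matrix.inv_def, Ring.inverse_eq_inv', det_charTF, Matrix.smul_apply, smul_eq_mul,
      charTF_eq_map_charmatrix, ← RingHom.mapMatrix_apply, ← RingHom.map_adjugate, div_eq_inv_mul]
    rfl
  rw [this]
  exact RatFunc.denom_div_dvd (A.charmatrix.adjugate i j) A.charpoly

end Matrices

/-! ### Schur stability and convergence of powers. -/

section Schur

variable {ι κ : Type*} [Fintype ι] [DecidableEq ι] [Fintype κ] [DecidableEq κ]

/-- All roots of the characteristic polynomial lie in the open unit disc. -/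
def SchurRoots (A : Matrix ι ι ℝ) : Prop :=
  ∀ s : ℂ, Polynomial.aeval s A.charpoly = 0 → ‖s‖ < 1

theorem mem_spectrum_map_iff (A : Matrix ι ι ℝ) (s : ℂ) :
    s ∈ spectrum ℂ (A.map (algebraMap ℝ ℂ)) ↔ Polynomial.aeval s A.charpoly = 0 := by
  rw [Matrix.mem_spectrum_iff_isRoot_charpoly, Matrix.charpoly_map, Polynomial.IsRoot.def,
    Polynomial.eval_map_algebraMap]

theorem isSchur_iff {n : ℕ} (A : Matrix (Fin n) (Fin n) ℝ) : IsSchur A ↔ SchurRoots A :=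
  forall_congr' fun s => by rw [mem_spectrum_map_iff]

theorem SchurRoots.reindex {A : Matrix ι ι ℝ} (hA : SchurRoots A) (e : ι ≃ κ) :
    SchurRoots (Matrix.reindex e e A) := by
  unfold SchurRoots
  rwa [Matrix.charpoly_reindex]

theorem SchurRoots.fromBlocks_zero₁₂ {A : Matrix ι ι ℝ} {D : Matrix κ κ ℝ} (hA : SchurRoots A)
    (hD : SchurRoots D) (C : Matrix κ ι ℝ) : SchurRoots (Matrix.fromBlocks A 0 C D) := by
  intro s hs
  rw [Matrix.charpoly_fromBlocks_zero₁₂, map_mul, mul_eq_zero] at hs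
  exact hs.elim (hA s) (hD s)

theorem SchurRoots.fromBlocks_zero₂₁ {A : Matrix ι ι ℝ} {D : Matrix κ κ ℝ} (hA : SchurRoots A)
    (hD : SchurRoots D) (B : Matrix ι κ ℝ) : SchurRoots (Matrix.fromBlocks A B 0 D) := by
  intro s hs
  rw [Matrix.charpoly_fromBlocks_zero₂₁, map_mul, mul_eq_zero] at hs
  exact hs.elim (hA s) (hD s)

theorem exists_eigenvector {A : Matrix ι ι ℝ} {s : ℂ} (hs : Polynomial.aeval s A.charpoly = 0) :
    ∃ w : ι → ℂ, w ≠ 0 ∧ (A.map (algebraMap ℝ ℂ)).mulVec w = s • w := by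
  rw [← mem_spectrum_map_iff, ← Matrix.spectrum_toLin',
    ← Module.End.hasEigenvalue_iff_mem_spectrum] at hs
  obtain ⟨w, hw⟩ := hs.exists_hasEigenvector
  exact ⟨w, hw.2, by simpa using hw.apply_eq_smul⟩

theorem pow_mulVec_eigenvector {M : Matrix ι ι ℂ} {s : ℂ} {w : ι → ℂ} (hw : M.mulVec w = s • w)
    (t : ℕ) : (M ^ t).mulVec w = s ^ t • w := by
  induction t with
  | zero => simp
  | succ t ih => rw [pow_succ, ← Matrix.mulVec_mulVec, hw, Matrix.mulVec_smul, ih, smul_smul,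
      pow_succ']

/-- On a complex eigenvector the powers act as `s ^ t`. Applying the hypothesis to its real and
imaginary parts gives `s ^ t → 0`, hence `‖s‖ < 1`. -/
theorem SchurRoots.of_tendsto {A : Matrix ι ι ℝ}
    (h : ∀ x : ι → ℝ, Tendsto (fun t : ℕ => (A ^ t).mulVec x) atTop (𝓝 0)) : SchurRoots A := by
  intro s hs
  obtain ⟨w, hw0, hw⟩ := exists_eigenvector hs
  obtain ⟨i, hi⟩ : ∃ i, w i ≠ 0 := by
    by_contra! hc
    exact hw0 (funext hc)
  have key (t : ℕ) : s ^ t * w i = (((A ^ t).mulVec (fun j => (w j).re) i : ℝ) : ℂ) +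
      (((A ^ t).mulVec (fun j => (w j).im) i : ℝ) : ℂ) * Complex.I := by
    have h1 := congrFun (pow_mulVec_eigenvector hw t) i
    rw [Pi.smul_apply, smul_eq_mul] at h1
    rw [← h1, ← RingHom.mapMatrix_apply, ← map_pow]
    simp only [Matrix.mulVec, dotProduct, RingHom.mapMatrix_apply, Matrix.map_apply,
      Complex.coe_algebraMap, Complex.ofReal_sum, Complex.ofReal_mul, Finset.sum_mul,
      ← Finset.sum_add_distrib]
    refine Finset.sum_congr rfl fun j _ => ?_
    conv_lhs => rw [← Complex.re_add_im (w j)]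
    ring
  have h2 : Tendsto (fun t : ℕ => s ^ t * w i) atTop (𝓝 0) := by
    simp only [key]
    have hr := (Complex.continuous_ofReal.tendsto 0).comp (tendsto_pi_nhds.1 (h fun j => (w j).re) i)
    have hm := (Complex.continuous_ofReal.tendsto 0).comp (tendsto_pi_nhds.1 (h fun j => (w j).im) i)
    simpa using hr.add (hm.mul_const Complex.I)
  have h3 : Tendsto (fun t : ℕ => s ^ t) atTop (𝓝 0) := by
    simpa [hi] using h2.mul_const (w i)⁻¹
  exact tendsto_pow_atTop_nhds_zero_iff_norm_lt_one.1 h3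

/-- Gelfand's formula: for `r` strictly between the spectral radius and `1`, eventually `‖a ^ t‖ ≤ r
^ t`. -/
theorem tendsto_pow_of_spectralRadius_lt_one {R : Type*} [NormedRing R] [NormedAlgebra ℂ R]
    [CompleteSpace R] {a : R} (h : spectralRadius ℂ a < 1) :
    Tendsto (fun t : ℕ => a ^ t) atTop (𝓝 0) := by
  obtain ⟨r, hr, hr1⟩ := ENNReal.lt_iff_exists_nnreal_btwn.1 h
  have hr1' : r < 1 := by exact_mod_cast hr1
  have hev := (spectrum.pow_nnnorm_pow_one_div_tendsto_nhds_spectralRadius a).eventually_lt_const hr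
  have hle : ∀ᶠ t : ℕ in atTop, ‖a ^ t‖ ≤ (r : ℝ) ^ t := by
    filter_upwards [hev, eventually_gt_atTop 0] with t ht h0
    have h1 : ((‖a ^ t‖₊ : ENNReal) ^ (1 / (t : ℝ))) ^ (t : ℝ) ≤ (r : ENNReal) ^ (t : ℝ) :=
      ENNReal.rpow_le_rpow ht.le (Nat.cast_nonneg t)
    rw [← ENNReal.rpow_mul, one_div, inv_mul_cancel₀ (by positivity), ENNReal.rpow_one,
      ENNReal.rpow_natCast] at h1
    exact_mod_cast h1
  exact squeeze_zero_norm' hle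
    (tendsto_pow_atTop_nhds_zero_of_lt_one r.coe_nonneg (by exact_mod_cast hr1'))

attribute [local instance] Matrix.linftyOpNormedRing Matrix.linftyOpNormedAlgebra in
theorem SchurRoots.tendsto_pow {A : Matrix ι ι ℝ} (hA : SchurRoots A) :
    Tendsto (fun t : ℕ => (A.map (algebraMap ℝ ℂ)) ^ t) atTop (𝓝 0) := by
  cases isEmpty_or_nonempty ι
  · exact tendsto_const_nhds.congr fun _ => Subsingleton.elim _ _
  refine tendsto_pow_of_spectralRadius_lt_one ?_
  have hne : (spectrum ℂ (A.map (algebraMap ℝ ℂ))).Nonempty := spectrum.nonempty _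
  obtain ⟨s, hs, h⟩ := spectrum.exists_nnnorm_eq_spectralRadius_of_nonempty hne
  rw [← h]
  exact_mod_cast hA s ((mem_spectrum_map_iff A s).1 hs)

theorem SchurRoots.tendsto {A : Matrix ι ι ℝ} (hA : SchurRoots A) (x : ι → ℝ) :
    Tendsto (fun t : ℕ => (A ^ t).mulVec x) atTop (𝓝 0) := by
  have h := hA.tendsto_pow
  rw [tendsto_pi_nhds]
  intro i
  have hA' (j : ι) : Tendsto (fun t : ℕ => (A ^ t) i j) atTop (𝓝 0) := by
    have := (Complex.continuous_re.tendsto 0).comp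
      (((continuous_id.matrix_elem i j).tendsto 0).comp h)
    refine this.congr fun t => ?_
    have hmap : A.map (algebraMap ℝ ℂ) ^ t = (A ^ t).map (algebraMap ℝ ℂ) :=
      (map_pow (algebraMap ℝ ℂ).mapMatrix A t).symm
    have := congrArg (fun M : Matrix ι ι ℂ => (M i j).re) hmap
    simpa using this
  simpa [Matrix.mulVec, dotProduct] using
    tendsto_finsetSum Finset.univ fun j _ => (hA' j).mul_const (x j)

end Schur

/-! ### Companion matrices and stable realizations of `RH∞` matrices. -/

open Polynomial in
/-- The companion matrix, in controllable form, of the monic polynomial of degree `d` with lower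
coefficients those of `a`. -/
def companionMatrix (a : ℝ[X]) (d : ℕ) : Matrix (Fin d) (Fin d) ℝ :=
  Matrix.of fun k l =>
    if (k : ℕ) + 1 = d then -a.coeff l else if (l : ℕ) = k + 1 then 1 else 0

section Companion

open Polynomial

variable {a : ℝ[X]} {d : ℕ}

theorem companionMatrix_map_mulVec {K : Type*} [CommRing K] (f : ℝ →+* K) (w : Fin d → K)
    (k : Fin d) : ((companionMatrix a d).map f).mulVec w k =
      if h : (k : ℕ) + 1 < d then w ⟨k + 1, h⟩ else -∑ l : Fin d, f (a.coeff l) * w l := by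
  simp only [Matrix.mulVec, dotProduct, companionMatrix, Matrix.map_apply, Matrix.of_apply]
  by_cases h : (k : ℕ) + 1 < d
  · rw [dif_pos h, Finset.sum_eq_single ⟨k + 1, h⟩]
    · simp [h.ne]
    · intro l _ hl
      have : (l : ℕ) ≠ k + 1 := fun hc => hl (Fin.ext hc)
      simp [h.ne, this]
    · simp
  · have h' : (k : ℕ) + 1 = d := by omega
    simp [h']

/-- The upper rows of the eigenvector equation force `w k = s ^ k * w 0`; the last row then reads
`a(s) * w 0 = 0` with `w 0 ≠ 0`, so every eigenvalue is a root of `a`. -/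
theorem schurRoots_companionMatrix (ha : a.Monic) (hd : a.natDegree = d)
    (hs : ∀ s : ℂ, aeval s a = 0 → ‖s‖ < 1) : SchurRoots (companionMatrix a d) := by
  intro s h
  obtain ⟨w, hw0, hw⟩ := exists_eigenvector h
  have hw' (k : Fin d) := (companionMatrix_map_mulVec (a := a) (algebraMap ℝ ℂ) w k).symm.trans
    (congrFun hw k)
  rcases Nat.eq_zero_or_pos d with h0 | h0
  · subst h0
    exact absurd (Subsingleton.elim w 0) hw0
  have hpow : ∀ (k : ℕ) (hk : k < d), w ⟨k, hk⟩ = s ^ k * w ⟨0, h0⟩ := by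
    intro k
    induction k with
    | zero => simp
    | succ k ih =>
      intro hk
      have := hw' ⟨k, by omega⟩
      simp only [hk, dif_pos, Pi.smul_apply, smul_eq_mul] at this
      rw [this, ih, pow_succ']
      ring
  have h00 : w ⟨0, h0⟩ ≠ 0 := by
    intro hc
    refine hw0 (funext fun k => ?_)
    rw [show k = ⟨k, k.2⟩ from rfl, hpow, hc, mul_zero]; rfl
  refine hs s ?_
  have hlast := hw' ⟨d - 1, by omega⟩
  have hd1 : ¬ (d - 1 + 1 < d) := by omega
  simp only [hd1, dif_neg, not_false_eq_true, Pi.smul_apply, smul_eq_mul] at hlast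
  rw [hpow, ← mul_assoc, ← pow_succ', Nat.sub_add_cancel h0] at hlast
  have hsum : ∑ l : Fin d, (algebraMap ℝ ℂ) (a.coeff l) * w l =
      (∑ l ∈ Finset.range d, (algebraMap ℝ ℂ) (a.coeff l) * s ^ l) * w ⟨0, h0⟩ := by
    rw [Finset.sum_mul, ← Fin.sum_univ_eq_sum_range
      (fun l => (algebraMap ℝ ℂ) (a.coeff l) * s ^ l * w ⟨0, h0⟩)]
    refine Finset.sum_congr rfl fun l _ => ?_
    rw [show w l = w ⟨l, l.2⟩ from rfl, hpow, mul_assoc]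
  rw [hsum] at hlast
  have : aeval s a * w ⟨0, h0⟩ = 0 := by
    rw [ha.as_sum, hd]
    simp only [map_add, map_pow, aeval_X, map_sum, map_mul, aeval_C]
    linear_combination -hlast
  exact (mul_eq_zero.1 this).resolve_right h00

/-- The state response `(1, z, …, z ^ (d - 1)) / a` of the companion realization. -/
def companionState (a : ℝ[X]) (d : ℕ) (k : Fin d) : RatFunc ℝ :=
  RatFunc.X ^ (k : ℕ) / algebraMap ℝ[X] (RatFunc ℝ) a

theorem charTF_companionMatrix_mulVec (ha : a.Monic) (hd : a.natDegree = d) (k : Fin d) :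
    (charTF (companionMatrix a d)).mulVec (companionState a d) k =
      if (k : ℕ) + 1 = d then 1 else 0 := by
  have ha0 : algebraMap ℝ[X] (RatFunc ℝ) a ≠ 0 := by simpa using ha.ne_zero
  rw [charTF, Matrix.sub_mulVec, Matrix.smul_mulVec, Matrix.one_mulVec, Pi.sub_apply,
    companionMatrix_map_mulVec, Pi.smul_apply, smul_eq_mul]
  split_ifs with h1 h2 h2
  · omega
  · simp only [companionState]
    ring
  · have hX : RatFunc.X ^ d + ∑ l : Fin d, RatFunc.C (a.coeff l) * RatFunc.X ^ (l : ℕ) =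
        algebraMap ℝ[X] (RatFunc ℝ) a := by
      conv_rhs => rw [ha.as_sum, hd]
      simp [← Fin.sum_univ_eq_sum_range, RatFunc.algebraMap_C, RatFunc.algebraMap_X]
    simp only [companionState]
    rw [sub_neg_eq_add, ← mul_div_assoc, ← pow_succ', h2]
    simp only [← mul_div_assoc]
    rw [← Finset.sum_div, ← add_div, hX, div_self ha0]
  · omega

end Companion

-- Over the denominator `a` the numerator has degree at most `d`. Splitting off its coefficient of
-- `z ^ d` as the feedthrough `D` leaves a numerator of degree below `d`, whose coefficients are the
-- output row `c`.
open Polynomial in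
theorem exists_eq_const_add_companion {f : RatFunc ℝ} (hf : IsProper f) {a : ℝ[X]} (ha : a.Monic)
    {d : ℕ} (hd : a.natDegree = d) (hdvd : f.denom ∣ a) :
    ∃ (c : Fin d → ℝ) (D : ℝ),
      f = ∑ k, RatFunc.C (c k) * companionState a d k + RatFunc.C D := by
  have ha0 : algebraMap ℝ[X] (RatFunc ℝ) a ≠ 0 := by simpa using ha.ne_zero
  obtain ⟨q, rfl⟩ := hdvd
  set a := f.denom * q with hadef
  have hq : q ≠ 0 := fun h => ha.ne_zero (by rw [hadef, h, mul_zero])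
  set p := f.num * q with hp
  have hfp : f = algebraMap ℝ[X] (RatFunc ℝ) p / algebraMap ℝ[X] (RatFunc ℝ) a := by
    have hq' : algebraMap ℝ[X] (RatFunc ℝ) q ≠ 0 := by simpa using hq
    rw [hp, hadef, map_mul, map_mul, mul_div_mul_right _ _ hq', RatFunc.num_div_denom]
  have hdeg : p.degree ≤ a.degree := by
    rw [hp, hadef, degree_mul, degree_mul]
    gcongr
    exact hf
  set D := p.coeff d
  set b := p - C D * a with hb
  have hcoeff (k : ℕ) (hk : d ≤ k) : b.coeff k = 0 := by
    rw [hb, coeff_sub, coeff_C_mul]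
    rcases hk.eq_or_lt with h | h
    · subst h
      rw [show a.coeff d = 1 by rw [← hd]; exact ha, mul_one, sub_self]
    · have h1 : a.degree < k := by
        rw [degree_eq_natDegree ha.ne_zero, hd]; exact_mod_cast h
      rw [coeff_eq_zero_of_degree_lt h1, coeff_eq_zero_of_degree_lt (hdeg.trans_lt h1)]
      ring
  refine ⟨fun k => b.coeff k, D, ?_⟩
  have hbsum : algebraMap ℝ[X] (RatFunc ℝ) b =
      ∑ k : Fin d, RatFunc.C (b.coeff k) * RatFunc.X ^ (k : ℕ) := by
    have hb' : b = ∑ k : Fin d, C (b.coeff k) * X ^ (k : ℕ) := by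
      rw [Fin.sum_univ_eq_sum_range (fun k => C (b.coeff k) * X ^ k)]
      ext k
      simp only [finsetSum_coeff, coeff_C_mul_X_pow, Finset.sum_ite_eq, Finset.mem_range]
      split_ifs with h
      exacts [rfl, hcoeff k (not_lt.1 h)]
    conv_lhs => rw [hb']
    simp [RatFunc.algebraMap_C, RatFunc.algebraMap_X]
  simp only [companionState, ← mul_div_assoc]
  rw [← Finset.sum_div, ← hbsum, hfp, div_add' _ _ _ ha0, hb, map_sub, map_mul _ (C D),
    RatFunc.algebraMap_C, sub_add_cancel]

section Reindex

variable {ι κ : Type*} [Fintype ι] [DecidableEq ι] [Fintype κ] [DecidableEq κ]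

omit [Fintype ι] [Fintype κ] in
theorem charTF_reindex (A : Matrix ι ι ℝ) (e : ι ≃ κ) :
    charTF (Matrix.reindex e e A) = Matrix.reindex e e (charTF A) := by
  ext i j
  simp [charTF, Matrix.one_apply]

omit [Fintype ι] [Fintype κ] in
theorem charTF_blockDiagonal (A : Matrix ι ι ℝ) :
    charTF (Matrix.blockDiagonal fun _ : κ => A) =
      Matrix.blockDiagonal fun _ : κ => charTF A := by
  ext ⟨i, k⟩ ⟨j, l⟩
  by_cases h : k = l <;> simp [charTF, Matrix.one_apply, Matrix.blockDiagonal_apply, h]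

theorem SchurRoots.blockDiagonal {A : Matrix ι ι ℝ} (hA : SchurRoots A) :
    SchurRoots (Matrix.blockDiagonal fun _ : κ => A) := by
  have h : (Matrix.blockDiagonal fun _ : κ => A).charmatrix =
      Matrix.blockDiagonal fun _ : κ => A.charmatrix := by
    ext1 ⟨i, k⟩ ⟨j, l⟩
    by_cases h : k = l <;> by_cases h' : i = j <;>
      simp [Matrix.blockDiagonal_apply, h, h']
  intro s hs
  rw [Matrix.charpoly, h, Matrix.det_blockDiagonal, map_prod, Finset.prod_eq_zero_iff] at hs
  obtain ⟨-, -, hs⟩ := hs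
  exact hA s hs

end Reindex

/-- Every stable proper transfer matrix has a realization with a Schur stable state matrix; `Ξ` is
the transfer matrix from the input to the state. -/
theorem exists_stable_realization {p m : ℕ} {Q : TF p m} (hQ : Q ∈ RHinf p m) :
    ∃ (q : ℕ) (A : Matrix (Fin q) (Fin q) ℝ) (B : Matrix (Fin q) (Fin m) ℝ)
      (C : Matrix (Fin p) (Fin q) ℝ) (D : Matrix (Fin p) (Fin m) ℝ) (Ξ : TF q m),
      SchurRoots A ∧ charTF A * Ξ = const B ∧ Q = const C * Ξ + const D := by
  classical
  -- A common denominator of all entries, so that a single companion matrix serves them all;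
  -- minimality of the realization is irrelevant.
  set a : Polynomial ℝ := ∏ i, ∏ j, (Q i j).denom with hadef
  have ha : a.Monic := Polynomial.monic_prod_of_monic _ _ fun i _ =>
    Polynomial.monic_prod_of_monic _ _ fun j _ => RatFunc.monic_denom _
  have hroots (s : ℂ) (hs : Polynomial.aeval s a = 0) : ‖s‖ < 1 := by
    rw [hadef, map_prod, Finset.prod_eq_zero_iff] at hs
    obtain ⟨i, -, hs⟩ := hs
    rw [map_prod, Finset.prod_eq_zero_iff] at hs
    obtain ⟨j, -, hs⟩ := hs
    exact (hQ i j).2 s hs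
  have hdvd (i : Fin p) (j : Fin m) : (Q i j).denom ∣ a :=
    (Finset.dvd_prod_of_mem (fun j => (Q i j).denom) (Finset.mem_univ j)).trans
      (Finset.dvd_prod_of_mem (fun i => ∏ j, (Q i j).denom) (Finset.mem_univ i))
  obtain ⟨d, hd⟩ : ∃ d, a.natDegree = d := ⟨_, rfl⟩
  choose c D hcD using fun i j => exists_eq_const_add_companion (hQ i j).1 ha hd (hdvd i j)
  have hA := schurRoots_companionMatrix ha hd hroots
  -- The state consists of one copy of the companion system for each input.
  let e : Fin d × Fin m ≃ Fin (d * m) := finProdFinEquiv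
  let B : Matrix (Fin d × Fin m) (Fin m) ℝ :=
    Matrix.of fun k j => if k.2 = j then (if (k.1 : ℕ) + 1 = d then 1 else 0) else 0
  let C : Matrix (Fin p) (Fin d × Fin m) ℝ := Matrix.of fun i k => c i k.2 k.1
  let Ξ : Matrix (Fin d × Fin m) (Fin m) (RatFunc ℝ) :=
    Matrix.of fun k j => if k.2 = j then companionState a d k.1 else 0
  have hΞ : charTF (Matrix.blockDiagonal fun _ : Fin m => companionMatrix a d) * Ξ =
      B.map RatFunc.C := by
    rw [charTF_blockDiagonal]
    ext ⟨k, j⟩ j'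
    have h := charTF_companionMatrix_mulVec ha hd k
    rw [Matrix.mul_apply, Fintype.sum_prod_type]
    by_cases hj : j = j'
    · subst hj
      simpa [Ξ, B, Matrix.blockDiagonal_apply, Matrix.mulVec, dotProduct, apply_ite] using h
    · simp [Ξ, B, Matrix.blockDiagonal_apply, hj]
  have hQeq : Q = C.map RatFunc.C * Ξ + const (Matrix.of D) := by
    ext i j
    rw [Matrix.add_apply, Matrix.mul_apply, Fintype.sum_prod_type, hcD i j]
    simp [Ξ, C, const]
  refine ⟨d * m, Matrix.reindex e e (Matrix.blockDiagonal fun _ : Fin m => companionMatrix a d),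
    B.submatrix e.symm id, C.submatrix id e.symm, Matrix.of D, Ξ.submatrix e.symm id,
    hA.blockDiagonal.reindex e, ?_, ?_⟩
  · rw [charTF_reindex, Matrix.reindex_apply, Matrix.submatrix_mul_equiv, hΞ]
    rfl
  · rw [const, ← Matrix.submatrix_map, Matrix.submatrix_mul_equiv]
    exact hQeq

/-! ### Block identities and state-space transfer matrices. -/

section Blocks

variable {ι κ μ ρ : Type*} [Fintype ι] [DecidableEq ι] [Fintype κ] [DecidableEq κ]

omit [Fintype ι] [Fintype κ] in
theorem charTF_fromBlocks (A : Matrix ι ι ℝ) (B : Matrix ι κ ℝ) (C : Matrix κ ι ℝ)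
    (D : Matrix κ κ ℝ) :
    charTF (Matrix.fromBlocks A B C D) = Matrix.fromBlocks (charTF A) (-B.map RatFunc.C)
      (-C.map RatFunc.C) (charTF D) := by
  ext (i | i) (j | j) <;> simp [charTF, Matrix.one_apply]

omit [DecidableEq ι] in
theorem map_C_mul (A : Matrix μ ι ℝ) (B : Matrix ι ρ ℝ) :
    (A * B).map RatFunc.C = A.map RatFunc.C * B.map RatFunc.C :=
  Matrix.map_mul

theorem map_C_add (A B : Matrix μ ρ ℝ) :
    (A + B).map RatFunc.C = A.map RatFunc.C + B.map RatFunc.C :=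
  Matrix.map_add _ (map_add _) A B

theorem map_C_sub (A B : Matrix μ ρ ℝ) :
    (A - B).map RatFunc.C = A.map RatFunc.C - B.map RatFunc.C :=
  Matrix.map_sub _ (map_sub _) A B

theorem map_C_neg (A : Matrix μ ρ ℝ) : (-A).map RatFunc.C = -A.map RatFunc.C := by
  ext; simp

omit [Fintype ι] in
theorem charTF_add (A B : Matrix ι ι ℝ) : charTF (A + B) = charTF A - B.map RatFunc.C := by
  rw [charTF, charTF, map_C_add, sub_sub]

end Blocks

theorem zIsub_eq {n : ℕ} (A : Matrix (Fin n) (Fin n) ℝ) : zIsub A = charTF A := rfl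

theorem isUnit_det_zIsub {n : ℕ} (A : Matrix (Fin n) (Fin n) ℝ) : IsUnit (zIsub A).det :=
  isUnit_det_charTF A

theorem entriesProper_const {p m : ℕ} (A : Matrix (Fin p) (Fin m) ℝ) : EntriesProper (const A) :=
  entriesProper_map_C A

theorem entriesStable_const {p m : ℕ} (A : Matrix (Fin p) (Fin m) ℝ) : EntriesStable (const A) :=
  entriesStable_map_C A

theorem entriesStrict_strictTransfer {n p m : ℕ} (A : Matrix (Fin n) (Fin n) ℝ)
    (B : Matrix (Fin n) (Fin m) ℝ) (C : Matrix (Fin p) (Fin n) ℝ) :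
    EntriesStrict (const C * (zIsub A)⁻¹ * const B) :=
  ((entriesStrict_inv_charTF A).mul_left (entriesProper_const C)).mul_right (entriesProper_const B)

theorem entriesProper_transfer {n p m : ℕ} (A : Matrix (Fin n) (Fin n) ℝ)
    (B : Matrix (Fin n) (Fin m) ℝ) (C : Matrix (Fin p) (Fin n) ℝ) (D : Matrix (Fin p) (Fin m) ℝ) :
    EntriesProper (transfer A B C D) :=
  (entriesStrict_strictTransfer A B C).entriesProper.add (entriesProper_const D)

/-- A transfer matrix can be identified from the response `Ξ` to any invertible input `Y`; this
avoids computing the resolvent of the controller. -/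
theorem transfer_eq_of_response {n p m : ℕ} {A : Matrix (Fin n) (Fin n) ℝ}
    {B : Matrix (Fin n) (Fin m) ℝ} {C : Matrix (Fin p) (Fin n) ℝ} {D : Matrix (Fin p) (Fin m) ℝ}
    {Ξ : TF n m} {Y : TF m m} {K : TF p m} (hΞ : zIsub A * Ξ = const B * Y) (hY : IsUnit Y)
    (hK : const C * Ξ + const D * Y = K * Y) : transfer A B C D = K := by
  have hΞ' : Ξ = (zIsub A)⁻¹ * (const B * Y) := by
    rw [← hΞ, Matrix.nonsing_inv_mul_cancel_left _ _ (isUnit_det_zIsub A)]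
  have h : transfer A B C D * Y = K * Y := by
    rw [← hK, hΞ', transfer, Matrix.add_mul]
    simp only [Matrix.mul_assoc]
  have hY' := (Matrix.isUnit_iff_isUnit_det _).1 hY
  rw [← Matrix.mul_nonsing_inv_cancel_right Y (transfer A B C D) hY', h,
    Matrix.mul_nonsing_inv_cancel_right _ _ hY']

/-! ### Algebra of the SLP equations. -/

namespace Plant

variable {n nw nu nz ny : ℕ} {P : Plant n nw nu nz ny}

theorem mem_slp_iff {R : TF n n} {M : TF nu n} {N : TF n ny} {L : TF nu ny} :
    (R, M, N, L) ∈ P.slp ↔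
      (zIsub P.A * R - const P.B2 * M = 1 ∧ zIsub P.A * N - const P.B2 * L = 0) ∧
      (R * zIsub P.A - N * const P.C2 = 1 ∧ M * zIsub P.A - L * const P.C2 = 0) ∧
      R ∈ sRHinf n n ∧ M ∈ sRHinf nu n ∧ N ∈ sRHinf n ny ∧ L ∈ RHinf nu ny := by
  simp only [slp, Set.mem_ofPred_eq, SLParam.block, SLParam.R, SLParam.M, SLParam.N, SLParam.L,
    Matrix.fromCols_mul_fromBlocks, Matrix.fromBlocks_mul_fromRows,
    Matrix.fromCols_inj.eq_iff, Matrix.fromRows_inj.eq_iff, Matrix.neg_mul, Matrix.mul_neg,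
    ← sub_eq_add_neg]

section Response

variable {R : TF n n} {M : TF nu n} {N : TF n ny} {L : TF nu ny}

/-- The first equation reads `z R = I + A R + B₂ M`, the identity plus a strictly proper matrix. -/
theorem isUnit_R_of_mem_slp (h : (R, M, N, L) ∈ P.slp) : IsUnit R := by
  obtain ⟨⟨e1, -⟩, -, hR, hM, -⟩ := mem_slp_iff.1 h
  rw [mem_sRHinf_iff] at hR hM
  have hE : EntriesStrict (-(const P.A * R + const P.B2 * M)) :=
    ((hR.1.mul_left (entriesProper_const _)).add (hM.1.mul_left (entriesProper_const _))).neg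
  have h1 : (RatFunc.X : RatFunc ℝ) • R = 1 - -(const P.A * R + const P.B2 * M) := by
    rw [zIsub, Matrix.sub_mul, Matrix.smul_mul, Matrix.one_mul] at e1
    rw [← e1]
    abel
  have h2 := isUnit_one_sub_of_entriesStrict hE
  rw [← h1, Matrix.isUnit_iff_isUnit_det, Matrix.det_smul] at h2
  exact (Matrix.isUnit_iff_isUnit_det _).2 (isUnit_of_mul_isUnit_right h2)

/-- `K C₂ = M R⁻¹` for the controller `K` of a system response. -/
theorem controller_mul_C2 (h : (R, M, N, L) ∈ P.slp) :
    SLParam.controller (R, M, N, L) * const P.C2 = M * R⁻¹ := by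
  have hR := (Matrix.isUnit_iff_isUnit_det _).1 (isUnit_R_of_mem_slp h)
  obtain ⟨-, ⟨e3, e4⟩, -⟩ := mem_slp_iff.1 h
  have e3' : N * const P.C2 = R * zIsub P.A - 1 := by rw [← e3]; abel
  rw [SLParam.controller, Matrix.sub_mul]
  simp only [SLParam.R, SLParam.M, SLParam.N, SLParam.L]
  rw [Matrix.mul_assoc _ N, e3', Matrix.mul_sub, Matrix.mul_one, Matrix.mul_assoc M,
    Matrix.nonsing_inv_mul_cancel_left _ _ hR, ← sub_eq_zero.1 e4]
  abel

theorem controller_mul_C2_mul_R (h : (R, M, N, L) ∈ P.slp) :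
    SLParam.controller (R, M, N, L) * const P.C2 * R = M := by
  rw [controller_mul_C2 h, Matrix.mul_assoc, Matrix.nonsing_inv_mul _
    ((Matrix.isUnit_iff_isUnit_det _).1 (isUnit_R_of_mem_slp h)), Matrix.mul_one]

theorem controller_add_mul_N (h : (R, M, N, L) ∈ P.slp) :
    SLParam.controller (R, M, N, L) + SLParam.controller (R, M, N, L) * const P.C2 * N = L := by
  rw [controller_mul_C2 h]
  simp [SLParam.controller, SLParam.R, SLParam.M, SLParam.N, SLParam.L]

/-- All four blocks are functions of `K`: `R = (zI - A - B₂ K C₂)⁻¹`, `N = R B₂ K`, `M = K C₂ R`, `L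
= K + K C₂ N`. -/
theorem controller_injOn : Set.InjOn SLParam.controller P.slp := by
  have key : ∀ θ ∈ P.slp, (zIsub P.A - const P.B2 * SLParam.controller θ * const P.C2) * θ.R = 1 ∧
      θ.N = θ.R * const P.B2 * SLParam.controller θ := by
    rintro ⟨R, M, N, L⟩ h
    have h1 := controller_mul_C2_mul_R h
    have h2 := controller_add_mul_N h
    set K := SLParam.controller (R, M, N, L)
    obtain ⟨⟨e1, e2⟩, -⟩ := mem_slp_iff.1 h
    simp only [SLParam.R, SLParam.N]
    have hR : (zIsub P.A - const P.B2 * K * const P.C2) * R = 1 := by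
      rw [Matrix.sub_mul, Matrix.mul_assoc _ _ R, Matrix.mul_assoc _ K,
        ← Matrix.mul_assoc K, h1, e1]
    refine ⟨hR, ?_⟩
    have h3 : (zIsub P.A - const P.B2 * K * const P.C2) * N = const P.B2 * K := by
      rw [Matrix.sub_mul, sub_eq_zero.1 e2, ← h2, Matrix.mul_add]
      simp only [Matrix.mul_assoc]
      abel
    rw [Matrix.mul_assoc, ← h3, ← Matrix.mul_assoc, mul_eq_one_comm.1 hR, Matrix.one_mul]
  rintro ⟨R, M, N, L⟩ h ⟨R', M', N', L'⟩ h' hK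
  obtain ⟨hR, hN⟩ := key _ h
  obtain ⟨hR', hN'⟩ := key _ h'
  have hM := controller_mul_C2_mul_R h
  have hM' := controller_mul_C2_mul_R h'
  have hL := controller_add_mul_N h
  have hL' := controller_add_mul_N h'
  rw [← hK] at hR' hN' hM' hL'
  simp only [SLParam.R, SLParam.N] at hR hR' hN hN'
  obtain rfl : R = R' := by
    rw [← Matrix.inv_eq_right_inv hR, ← Matrix.inv_eq_right_inv hR']
  obtain rfl : N = N' := by rw [hN, hN']
  obtain rfl : M = M' := by rw [← hM, ← hM']
  obtain rfl : L = L' := by rw [← hL, ← hL']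
  rfl

theorem P22_eq (hD22 : P.D22 = 0) : P.P22 = const P.C2 * (zIsub P.A)⁻¹ * const P.B2 := by
  rw [P22, transfer, hD22]
  ext; simp [const]

theorem N_eq_of_mem_slp (h : (R, M, N, L) ∈ P.slp) :
    N = (zIsub P.A)⁻¹ * (const P.B2 * L) := by
  obtain ⟨⟨-, e2⟩, -⟩ := mem_slp_iff.1 h
  rw [← sub_eq_zero.1 e2, Matrix.nonsing_inv_mul_cancel_left _ _ (isUnit_det_zIsub _)]

/-- Substitute `N = (zI - A)⁻¹ B₂ L` into `L = K + K C₂ N`; the product `C₂ (zI - A)⁻¹ B₂` is `P₂₂`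
because `D₂₂ = 0`. -/
theorem controller_feedback (hD22 : P.D22 = 0) (h : (R, M, N, L) ∈ P.slp) :
    L = SLParam.controller (R, M, N, L) + SLParam.controller (R, M, N, L) * P.P22 * L := by
  have hN := N_eq_of_mem_slp h
  have hL := controller_add_mul_N h
  set K := SLParam.controller (R, M, N, L)
  conv_lhs => rw [← hL, hN]
  rw [P22_eq hD22]
  simp only [Matrix.mul_assoc]

end Response

end Plant

theorem one_sub_mul_one_add {p m : ℕ} {G : TF m p} {K L : TF p m} (h : L = K + K * G * L) :
    (1 - G * K) * (1 + G * L) = 1 := by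
  have h' : K * (G * L) = L - K := by rw [← Matrix.mul_assoc, eq_sub_iff_add_eq', ← h]
  rw [Matrix.sub_mul, Matrix.one_mul, Matrix.mul_add, Matrix.mul_one, Matrix.mul_assoc, h',
    Matrix.mul_sub]
  abel

theorem mul_inv_one_sub {p m : ℕ} {G : TF m p} {K L : TF p m} (h : L = K + K * G * L) :
    K * (1 - G * K)⁻¹ = L := by
  rw [Matrix.inv_eq_right_inv (one_sub_mul_one_add h), Matrix.mul_add, Matrix.mul_one,
    ← Matrix.mul_assoc, ← h]

namespace Plant

variable {n nw nu nz ny : ℕ} {P : Plant n nw nu nz ny}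

/-- By the feedback identity the left side is `P₁₁ + P₁₂ L P₂₁`. The SLP equations express `R`, `M`
and `N` through `L` and `(zI - A)⁻¹`, and both sides expand to the same sum. -/
theorem closedLoop_controller (hD22 : P.D22 = 0) {θ : SLParam n nu ny} (h : θ ∈ P.slp) :
    P.closedLoop θ.controller = P.slpResponse θ := by
  obtain ⟨R, M, N, L⟩ := θ
  have hL := mul_inv_one_sub (controller_feedback hD22 h)
  have hN := N_eq_of_mem_slp h
  obtain ⟨⟨e1, -⟩, ⟨-, e4⟩, -⟩ := mem_slp_iff.1 h
  have hM : M = L * const P.C2 * (zIsub P.A)⁻¹ := by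
    rw [← sub_eq_zero.1 e4, Matrix.mul_nonsing_inv_cancel_right _ _ (isUnit_det_zIsub _)]
  have hR : R = (zIsub P.A)⁻¹ * (1 + const P.B2 * M) := by
    rw [← e1, sub_add_cancel, Matrix.nonsing_inv_mul_cancel_left _ _ (isUnit_det_zIsub _)]
  rw [closedLoop, Matrix.mul_assoc P.P12, hL, slpResponse, SLParam.block]
  simp only [SLParam.R, SLParam.M, SLParam.N, SLParam.L, Matrix.fromCols_mul_fromBlocks,
    Matrix.fromCols_mul_fromRows]
  rw [hR, hN, hM, P11, P12, P21, transfer, transfer, transfer]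
  simp only [Matrix.mul_add, Matrix.add_mul, Matrix.mul_assoc, Matrix.mul_one]
  abel

theorem slpResponse_mem_RHinf {θ : SLParam n nu ny} (h : θ ∈ P.slp) :
    P.slpResponse θ ∈ RHinf nz nw := by
  obtain ⟨R, M, N, L⟩ := θ
  obtain ⟨-, -, hR, hM, hN, hL⟩ := mem_slp_iff.1 h
  rw [mem_sRHinf_iff] at hR hM hN
  rw [mem_RHinf_iff] at hL ⊢
  rw [slpResponse, SLParam.block]
  simp only [SLParam.R, SLParam.M, SLParam.N, SLParam.L, Matrix.fromCols_mul_fromBlocks,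
    Matrix.fromCols_mul_fromRows]
  have key {T : Subring (RatFunc ℝ)} (hc : ∀ {p m : ℕ} (A : Matrix (Fin p) (Fin m) ℝ),
      EntriesIn T (const A)) (hR : EntriesIn T R) (hM : EntriesIn T M) (hN : EntriesIn T N)
      (hL : EntriesIn T L) :
      EntriesIn T ((const P.C1 * R + const P.D12 * M) * const P.B1 +
        (const P.C1 * N + const P.D12 * L) * const P.D21 + const P.D11) :=
    (((((hc _).mul hR).add ((hc _).mul hM)).mul (hc _)).add
      ((((hc _).mul hN).add ((hc _).mul hL)).mul (hc _))).add (hc _)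
  exact ⟨key entriesProper_const hR.1.entriesProper hM.1.entriesProper hN.1.entriesProper hL.1,
    key entriesStable_const hR.2 hM.2 hN.2 hL.2⟩

end Plant

/-! ### From a stabilizing controller to a system response. -/

section Recursion

variable {ι : Type*} [Fintype ι] [DecidableEq ι]

theorem SchurRoots.tendsto_of_recursion {A : Matrix ι ι ℝ} (hA : SchurRoots A) {x : ℕ → ι → ℝ}
    (hx : ∀ t, x (t + 1) = A.mulVec (x t)) : Tendsto x atTop (𝓝 0) := by
  refine (hA.tendsto (x 0)).congr fun t => ?_
  induction t with
  | zero => simp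
  | succ t ih => rw [hx, ← ih, Matrix.mulVec_mulVec, ← pow_succ']

end Recursion

namespace Plant

variable {n nw nu nz ny : ℕ} {P : Plant n nw nu nz ny}

/-- The state matrix of the interconnection of the plant (with `D₂₂ = 0`) and a controller. -/
def closedLoopMatrix (P : Plant n nw nu nz ny) {k : ℕ} (κ : Controller k nu ny) :
    Matrix (Fin n ⊕ Fin k) (Fin n ⊕ Fin k) ℝ :=
  Matrix.fromBlocks (P.A + P.B2 * κ.D * P.C2) (P.B2 * κ.C) (κ.B * P.C2) κ.A

/-- The orbit of the closed-loop matrix from any initial state is an undisturbed trajectory of the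
interconnection, so internal stability makes all its orbits tend to zero. -/
theorem schurRoots_closedLoopMatrix (hD22 : P.D22 = 0) {k : ℕ} {κ : Controller k nu ny}
    (h : P.InternallyStable κ) : SchurRoots (P.closedLoopMatrix κ) := by
  refine SchurRoots.of_tendsto fun s => ?_
  set T := P.closedLoopMatrix κ with hT
  obtain ⟨h1, h2⟩ := h.2 (fun t => ((T ^ t).mulVec s) ∘ Sum.inl)
    (fun t => ((T ^ t).mulVec s) ∘ Sum.inr)
    (fun t => κ.C.mulVec (((T ^ t).mulVec s) ∘ Sum.inr) +
      κ.D.mulVec (P.C2.mulVec (((T ^ t).mulVec s) ∘ Sum.inl)))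
    (fun t => P.C2.mulVec (((T ^ t).mulVec s) ∘ Sum.inl)) (by
      intro t
      have hs : (T ^ (t + 1)).mulVec s = T.mulVec ((T ^ t).mulVec s) := by
        rw [pow_succ', Matrix.mulVec_mulVec]
      beta_reduce
      rw [hs]
      generalize (T ^ t).mulVec s = v
      rw [hT, closedLoopMatrix, Matrix.fromBlocks_mulVec, Sum.elim_comp_inl, Sum.elim_comp_inr,
        hD22]
      refine ⟨?_, ?_, ?_, rfl⟩
      · simp only [Matrix.mulVec_zero, add_zero, Matrix.mulVec_add, Matrix.add_mulVec,
          Matrix.mulVec_mulVec, Matrix.mul_assoc]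
        abel
      · simp
      · rw [Matrix.mulVec_mulVec]
        abel)
  rw [tendsto_pi_nhds] at h1 h2 ⊢
  rintro (i | i)
  exacts [h1 i, h2 i]

/-- The system response is read off the resolvent of the closed-loop matrix, whose entries are
strictly proper and stable. The two sides of the inverse identity, `Φ⁻¹ Φ = I` and `Φ Φ⁻¹ = I`,
yield the two groups of SLP equations. -/
theorem exists_slp_of_mem_Cstab (hD22 : P.D22 = 0) {K : TF nu ny} (hK : K ∈ P.Cstab) :
    ∃ θ ∈ P.slp, SLParam.controller θ = K := by
  obtain ⟨k, κ, -, -, rfl, hint⟩ := hK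
  have hS := schurRoots_closedLoopMatrix hD22 hint
  have hdet := isUnit_det_charTF (P.closedLoopMatrix κ)
  have hstable := entriesStable_inv_charTF hS
  have hstrict := entriesStrict_inv_charTF (P.closedLoopMatrix κ)
  have hΦ1 := Matrix.mul_nonsing_inv _ hdet
  have hΦ2 := Matrix.nonsing_inv_mul _ hdet
  set Φ := (charTF (P.closedLoopMatrix κ))⁻¹
  obtain ⟨R, Φ₁₂, Φ₂₁, Φ₂₂, hΦ⟩ : ∃ a b c d, Φ = Matrix.fromBlocks a b c d :=
    ⟨_, _, _, _, (Matrix.fromBlocks_toBlocks Φ).symm⟩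
  have hs₁₁ : EntriesStable R := fun i j => by
    simpa [hΦ] using hstable (Sum.inl i) (Sum.inl j)
  have hs₁₂ : EntriesStable Φ₁₂ := fun i j => by
    simpa [hΦ] using hstable (Sum.inl i) (Sum.inr j)
  have hs₂₁ : EntriesStable Φ₂₁ := fun i j => by
    simpa [hΦ] using hstable (Sum.inr i) (Sum.inl j)
  have hs₂₂ : EntriesStable Φ₂₂ := fun i j => by
    simpa [hΦ] using hstable (Sum.inr i) (Sum.inr j)
  have hp₁₁ : EntriesStrict R := fun i j => by
    simpa [hΦ] using hstrict (Sum.inl i) (Sum.inl j)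
  have hp₁₂ : EntriesStrict Φ₁₂ := fun i j => by
    simpa [hΦ] using hstrict (Sum.inl i) (Sum.inr j)
  have hp₂₁ : EntriesStrict Φ₂₁ := fun i j => by
    simpa [hΦ] using hstrict (Sum.inr i) (Sum.inl j)
  have hp₂₂ : EntriesStrict Φ₂₂ := fun i j => by
    simpa [hΦ] using hstrict (Sum.inr i) (Sum.inr j)
  clear_value Φ
  subst hΦ
  have hchar : charTF (P.closedLoopMatrix κ) = Matrix.fromBlocks
      (zIsub P.A - const P.B2 * const κ.D * const P.C2) (-(const P.B2 * const κ.C))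
      (-(const κ.B * const P.C2)) (zIsub κ.A) := by
    rw [closedLoopMatrix, charTF_fromBlocks, charTF_add]
    simp only [map_C_mul]
    rfl
  rw [hchar, Matrix.fromBlocks_multiply, ← Matrix.fromBlocks_one, Matrix.fromBlocks_inj] at hΦ1 hΦ2
  obtain ⟨a₁₁, a₁₂, a₂₁, a₂₂⟩ := hΦ1
  obtain ⟨b₁₁, b₁₂, b₂₁, b₂₂⟩ := hΦ2
  set Z := zIsub P.A
  set b := const P.B2
  set c := const P.C2
  set d := const κ.D
  set ck := const κ.C
  set bk := const κ.B
  -- `R` and `Φ₂₁` are the responses of plant and controller state to a state disturbance, `N` and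
  -- `V` those to measurement noise; `M` and `L` are the corresponding responses of `u = C_k ξ + D_k
  -- y`.
  obtain ⟨M, hM⟩ : ∃ M, M = d * c * R + ck * Φ₂₁ := ⟨_, rfl⟩
  obtain ⟨N, hN⟩ : ∃ N, N = R * b * d + Φ₁₂ * bk := ⟨_, rfl⟩
  obtain ⟨V, hV⟩ : ∃ V, V = Φ₂₁ * b * d + Φ₂₂ * bk := ⟨_, rfl⟩
  obtain ⟨L, hL⟩ : ∃ L, L = d + d * c * N + ck * V := ⟨_, rfl⟩
  have e1 : Z * R - b * M = 1 := by
    rw [← a₁₁, hM]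
    simp only [Matrix.sub_mul, Matrix.mul_add, Matrix.neg_mul, Matrix.mul_assoc]
    abel
  have hZN : (Z - b * d * c) * N - b * ck * V = b * d := by
    have := congrArg₂ (fun X Y => X * (b * d) + Y * bk) a₁₁ a₁₂
    simp only [Matrix.one_mul, Matrix.zero_mul, add_zero] at this
    refine Eq.trans ?_ this
    rw [hN, hV]
    simp only [Matrix.sub_mul, Matrix.mul_add, Matrix.add_mul, Matrix.neg_mul, Matrix.mul_assoc]
    abel
  have e2 : Z * N - b * L = 0 := by
    rw [← sub_eq_zero.2 hZN, hL]
    simp only [Matrix.sub_mul, Matrix.mul_add, Matrix.mul_assoc]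
    abel
  have e3 : R * Z - N * c = 1 := by
    rw [← b₁₁, hN]
    simp only [Matrix.mul_sub, Matrix.add_mul, Matrix.mul_neg, Matrix.mul_assoc]
    abel
  have hVc : V * c = Φ₂₁ * Z := by
    rw [eq_comm, ← sub_eq_zero, ← b₂₁, hV]
    simp only [Matrix.mul_sub, Matrix.add_mul, Matrix.mul_neg, Matrix.mul_assoc]
    abel
  have e4 : M * Z - L * c = 0 := by
    have hNc : N * c = R * Z - 1 := by rw [← e3]; abel
    rw [hL, Matrix.add_mul, Matrix.add_mul, Matrix.mul_assoc _ N, hNc, Matrix.mul_assoc ck, hVc, hM]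
    simp only [Matrix.mul_sub, Matrix.add_mul, Matrix.mul_one, Matrix.mul_assoc]
    abel
  have sb := entriesStable_const P.B2
  have sc := entriesStable_const P.C2
  have sd := entriesStable_const κ.D
  have sck := entriesStable_const κ.C
  have sbk := entriesStable_const κ.B
  have pb := entriesProper_const P.B2
  have pc := entriesProper_const P.C2
  have pd := entriesProper_const κ.D
  have pck := entriesProper_const κ.C
  have pbk := entriesProper_const κ.B
  have sN : EntriesStable N := hN ▸ ((hs₁₁.mul sb).mul sd).add (hs₁₂.mul sbk)
  have sV : EntriesStable V := hV ▸ ((hs₂₁.mul sb).mul sd).add (hs₂₂.mul sbk)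
  have pN : EntriesStrict N := hN ▸ ((hp₁₁.mul_right pb).mul_right pd).add (hp₁₂.mul_right pbk)
  have pV : EntriesStrict V := hV ▸ ((hp₂₁.mul_right pb).mul_right pd).add (hp₂₂.mul_right pbk)
  have hMmem : M ∈ sRHinf nu n := by
    rw [hM]
    exact mem_sRHinf_iff.2 ⟨(hp₁₁.mul_left (pd.mul pc)).add (hp₂₁.mul_left pck),
      ((sd.mul sc).mul hs₁₁).add (sck.mul hs₂₁)⟩
  have hLmem : L ∈ RHinf nu ny := by
    rw [hL]
    exact mem_RHinf_iff.2
      ⟨(pd.add ((pd.mul pc).mul pN.entriesProper)).add (pck.mul pV.entriesProper),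
        (sd.add ((sd.mul sc).mul sN)).add (sck.mul sV)⟩
  have hmem : (R, M, N, L) ∈ P.slp := mem_slp_iff.2 ⟨⟨e1, e2⟩, ⟨e3, e4⟩,
    mem_sRHinf_iff.2 ⟨hp₁₁, hs₁₁⟩, hMmem, mem_sRHinf_iff.2 ⟨pN, sN⟩, hLmem⟩
  refine ⟨_, hmem, ?_⟩
  have hZk := isUnit_det_zIsub κ.A
  -- Eliminating the controller state turns the responses into `M = K C₂ R` and `L = K + K C₂ N`,
  -- from which `L - M R⁻¹ N = K`.
  have hΦ₂₁ : Φ₂₁ = (zIsub κ.A)⁻¹ * (bk * c * R) := by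
    rw [← Matrix.nonsing_inv_mul_cancel_left _ Φ₂₁ hZk]
    congr 1
    rw [← sub_eq_zero, ← a₂₁, Matrix.neg_mul]
    abel
  have hV' : V = (zIsub κ.A)⁻¹ * (bk + bk * c * N) := by
    rw [← Matrix.nonsing_inv_mul_cancel_left _ V hZk]
    congr 1
    have := congrArg₂ (fun X Y => X * (b * d) + Y * bk) a₂₁ a₂₂
    simp only [Matrix.one_mul, Matrix.zero_mul, zero_add] at this
    refine Eq.trans ?_ (congrArg (· + bk * c * N) this)
    rw [hV, hN]
    simp only [Matrix.mul_add, Matrix.add_mul, Matrix.neg_mul, Matrix.mul_assoc]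
    abel
  have hKt : κ.tf = ck * (zIsub κ.A)⁻¹ * bk + d := rfl
  have hMK : M = κ.tf * c * R := by
    rw [hKt, hM, hΦ₂₁]
    simp only [Matrix.add_mul, Matrix.mul_assoc]
    abel
  have hLK : L = κ.tf + κ.tf * c * N := by
    rw [hKt, hL, hV']
    simp only [Matrix.mul_add, Matrix.add_mul, Matrix.mul_assoc]
    abel
  have hRu := (Matrix.isUnit_iff_isUnit_det _).1 (isUnit_R_of_mem_slp hmem)
  change L - M * R⁻¹ * N = _
  rw [hLK, hMK, Matrix.mul_nonsing_inv_cancel_right _ _ hRu]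
  abel

end Plant

/-! ### Quadratic invariance and the Neumann series. -/

section QuadraticInvariance

variable {nu ny : ℕ} {S : Submodule ℝ (TF nu ny)} {G : TF ny nu}

theorem QuadInvariant.neg (h : QuadInvariant S G) : QuadInvariant S (-G) := fun K hK => by
  simpa using S.neg_mem (h K hK)

/-- Polarizing the quadratic condition puts `K G Y + Y G K` in `S` for `K, Y ∈ S`. For `Y = (K G)ᵗ
K` both terms equal `(K G)ᵗ⁺¹ K`, and the factor `2` can be divided out. -/
theorem QuadInvariant.mul_pow_mem (h : QuadInvariant S G) {K : TF nu ny} (hK : K ∈ S) (t : ℕ) :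
    (K * G) ^ t * K ∈ S := by
  induction t with
  | zero => simpa using hK
  | succ t ih =>
    set Y := (K * G) ^ t * K with hY
    have h1 : (K + Y) * G * (K + Y) = K * G * K + Y * G * Y + (K * G * Y + Y * G * K) := by
      simp only [Matrix.mul_add, Matrix.add_mul]
      abel
    have h2 : K * G * Y + Y * G * K ∈ S := by
      have := S.sub_mem (h _ (S.add_mem hK ih)) (S.add_mem (h _ hK) (h _ ih))
      rwa [h1, add_sub_cancel_left] at this
    have h3 : K * G * Y = (K * G) ^ (t + 1) * K := by
      rw [hY, pow_succ', Matrix.mul_assoc (K * G)]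
    have h4 : Y * G * K = (K * G) ^ (t + 1) * K := by
      rw [hY, pow_succ, Matrix.mul_assoc, Matrix.mul_assoc, Matrix.mul_assoc, Matrix.mul_assoc]
    rw [h3, h4, ← two_smul ℝ] at h2
    exact (S.smul_mem_iff (two_ne_zero)).1 h2

theorem eq_sum_add_of_feedback {K L : TF nu ny} (h : L = K + K * G * L) (T : ℕ) :
    L = ∑ t ∈ Finset.range T, (K * G) ^ t * K + (K * G) ^ T * L := by
  induction T with
  | zero => simp
  | succ T ih =>
    rw [Finset.sum_range_succ, pow_succ, add_assoc, Matrix.mul_assoc _ (K * G) L, ← Matrix.mul_add,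
      ← h]
    exact ih

/-- The valuation is discrete: a value below `1` is at most `exp (-1)`, which one factor `z`
compensates. -/
theorem entriesProper_X_smul_strict {ι κ : Type*} {E : Matrix ι κ (RatFunc ℝ)}
    (hE : EntriesStrict E) : EntriesProper ((RatFunc.X : RatFunc ℝ) • E) := fun i j => by
  by_cases h0 : E i j = 0
  · simp [h0]
  · have h := hE i j
    rw [Valuation.mem_integer_iff, Matrix.smul_apply, smul_eq_mul, map_mul, valInfty_X]
    rw [valInfty_of_ne_zero h0, ← WithZero.exp_zero] at h ⊢
    rw [WithZero.exp_lt_exp] at h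
    rw [← WithZero.exp_add, WithZero.exp_le_exp]
    omega

theorem entriesProper_pow {ι : Type*} [Fintype ι] [DecidableEq ι] {E : Matrix ι ι (RatFunc ℝ)}
    (hE : EntriesProper E) (t : ℕ) : EntriesProper (E ^ t) := by
  induction t with
  | zero => rw [pow_zero]; exact EntriesIn.one
  | succ t ih => rw [pow_succ]; exact ih.mul hE

/-- A quadratically invariant closed subspace contains `L = K (I - G K)⁻¹` along with `K`. -/
theorem mem_of_feedback (hclosed : IsClosedSubspace S) (hQI : QuadInvariant S G)
    (hG : EntriesStrict G) {K L : TF nu ny} (hK : EntriesProper K) (hL : EntriesProper L)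
    (h : L = K + K * G * L) (hKS : K ∈ S) : L ∈ S := by
  refine hclosed L (fun i j => isProper_iff.2 (hL i j)) fun T =>
    ⟨∑ t ∈ Finset.range T, (K * G) ^ t * K, S.sum_mem fun t _ => hQI.mul_pow_mem hKS t, ?_⟩
  -- The remainder of the Neumann series is `(K G)ᵀ L`, with `T` the exponent; distributing one `z`
  -- to each strictly proper factor `K G` shows that `z ^ T` times it is proper.
  have h1 : (RatFunc.X : RatFunc ℝ) ^ T • (L - ∑ t ∈ Finset.range T, (K * G) ^ t * K) =
      ((RatFunc.X : RatFunc ℝ) • (K * G)) ^ T * L := by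
    conv_lhs => rw [eq_sub_of_add_eq' (eq_sum_add_of_feedback h T).symm |>.symm]
    rw [smul_pow, Matrix.smul_mul]
  intro i j
  have h2 := ((entriesProper_pow (entriesProper_X_smul_strict (hG.mul_left hK)) T).mul hL) i j
  rw [← h1] at h2
  exact isProper_iff.2 h2

end QuadraticInvariance

/-! ### From a system response to a stabilizing controller. -/

theorem map_C_eq_const {p m : ℕ} (A : Matrix (Fin p) (Fin m) ℝ) : A.map RatFunc.C = const A := rfl

namespace Plant

variable {n nw nu nz ny : ℕ} {P : Plant n nw nu nz ny}

/-- Membership in `Cstab` from a realization whose states are indexed by an arbitrary finite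
type. -/
theorem mem_Cstab_of_realization (hD22 : P.D22 = 0) {ι : Type*} [Fintype ι] [DecidableEq ι]
    {k : ℕ} (e : ι ≃ Fin k) {A : Matrix ι ι ℝ} {B : Matrix ι (Fin ny) ℝ}
    {C : Matrix (Fin nu) ι ℝ} {D : Matrix (Fin nu) (Fin ny) ℝ}
    {F : Matrix (Fin ny) ι ℝ} {H : Matrix ι (Fin nu) ℝ}
    (hF : SchurRoots (A + B * F)) (hH : SchurRoots (A + H * C))
    {Ξ : Matrix ι (Fin ny) (RatFunc ℝ)} {Y : TF ny ny} {K : TF nu ny}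
    (hΞ : charTF A * Ξ = B.map RatFunc.C * Y) (hY : IsUnit Y)
    (hK : C.map RatFunc.C * Ξ + const D * Y = K * Y)
    (hstable : ∀ (x : ℕ → Fin n → ℝ) (ξ : ℕ → ι → ℝ),
      (∀ t, x (t + 1) = P.A.mulVec (x t) +
        P.B2.mulVec (C.mulVec (ξ t) + D.mulVec (P.C2.mulVec (x t)))) →
      (∀ t, ξ (t + 1) = A.mulVec (ξ t) + B.mulVec (P.C2.mulVec (x t))) →
      Tendsto x atTop (𝓝 0) ∧ Tendsto ξ atTop (𝓝 0)) :
    K ∈ P.Cstab := by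
  refine ⟨k, ⟨Matrix.reindex e e A, B.submatrix e.symm id, C.submatrix id e.symm, D⟩,
    ⟨F.submatrix id e.symm, ?_⟩, ⟨H.submatrix e.symm id, ?_⟩, ?_, ?_, ?_⟩
  · rw [isSchur_iff]
    exact hF.reindex e
  · rw [isSchur_iff]
    exact hH.reindex e
  · refine transfer_eq_of_response (Ξ := Ξ.submatrix e.symm id) ?_ hY ?_
    · rw [zIsub_eq, charTF_reindex, Matrix.reindex_apply, Matrix.submatrix_mul_equiv, hΞ]
      rfl
    · rw [← hK, const, ← Matrix.submatrix_map, Matrix.submatrix_mul_equiv]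
      rfl
  · simp [hD22]
  · intro x ξ u y h
    have hy (t : ℕ) : y t = P.C2.mulVec (x t) := by simpa [hD22] using (h t).2.1
    have hu (t : ℕ) : u t = C.mulVec (ξ t ∘ e) + D.mulVec (P.C2.mulVec (x t)) := by
      rw [(h t).2.2.2, hy]
      congr 1
      simpa using Matrix.submatrix_mulVec_equiv C (ξ t) id e.symm
    obtain ⟨h1, h2⟩ := hstable x (fun t => ξ t ∘ e)
      (fun t => by rw [← hu]; simpa using (h t).1)
      (fun t => by
        rw [(h t).2.2.1, hy]
        funext i
        have := congrFun (Matrix.submatrix_mulVec_equiv A (ξ t) e.symm e.symm) (e i)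
        simp only [Matrix.reindex_apply, Function.comp_apply, Pi.add_apply, this]
        simp [Matrix.mulVec])
    refine ⟨h1, tendsto_pi_nhds.2 fun i => ?_⟩
    simpa using tendsto_pi_nhds.1 h2 (e.symm i)

/-- The Youla construction: with stabilizing `F` and `H`, run the observer `x̂⁺ = A x̂ + B₂ u - H e`
with innovation `e = y - C₂ x̂`, and apply `u = F x̂ + Q e` for a suitable stable `Q`. Such a
controller always stabilizes the plant; `Q` is chosen so that its transfer matrix is `K`. -/
theorem controller_mem_Cstab (hstab : IsStabilizable P.A P.B2) (hdet : IsDetectable P.A P.C2)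
    (hD22 : P.D22 = 0) {θ : SLParam n nu ny} (h : θ ∈ P.slp) : θ.controller ∈ P.Cstab := by
  obtain ⟨R, M, N, L⟩ := θ
  obtain ⟨F, hF⟩ := hstab
  obtain ⟨H, hH⟩ := hdet
  rw [isSchur_iff] at hF hH
  have hMK := controller_mul_C2_mul_R h
  have hLK := controller_add_mul_N h
  obtain ⟨⟨e1, e2⟩, -, hR, hM, hN, hL⟩ := mem_slp_iff.1 h
  set K := SLParam.controller (R, M, N, L)
  rw [mem_sRHinf_iff] at hR hM hN
  rw [mem_RHinf_iff] at hL
  have hQ : const F * R * const H - const F * N - M * const H + L ∈ RHinf nu ny := by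
    have key {T : Subring (RatFunc ℝ)} (hF : EntriesIn T (const F)) (hH : EntriesIn T (const H))
        (hR : EntriesIn T R) (hM : EntriesIn T M) (hN : EntriesIn T N) (hL : EntriesIn T L) :
        EntriesIn T (const F * R * const H - const F * N - M * const H + L) :=
      ((((hF.mul hR).mul hH).sub (hF.mul hN)).sub (hM.mul hH)).add hL
    exact mem_RHinf_iff.2 ⟨key (entriesProper_const F) (entriesProper_const H)
        hR.1.entriesProper hM.1.entriesProper hN.1.entriesProper hL.1,
      key (entriesStable_const F) (entriesStable_const H) hR.2 hM.2 hN.2 hL.2⟩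
  obtain ⟨q, Aq, Bq, Cq, Dq, Ξq, hAq, hΞq, hQeq⟩ := exists_stable_realization hQ
  -- `X` and `U` are the responses of `x̂` and `u` to the innovation `e`, with `y = e + C₂ X`. The
  -- requirement `U = F X + Q` dictates the formula for `Q`.
  obtain ⟨X, hX⟩ : ∃ X, X = N - R * const H := ⟨_, rfl⟩
  obtain ⟨U, hU⟩ : ∃ U, U = L - M * const H := ⟨_, rfl⟩
  have hUX : U = const F * X + const Cq * Ξq + const Dq := by
    rw [add_assoc, ← hQeq, hU, hX, Matrix.mul_sub, Matrix.mul_assoc]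
    abel
  have hXeq : zIsub P.A * X = const P.B2 * U - const H := by
    have h1 : zIsub P.A * R = 1 + const P.B2 * M := by rw [← e1]; abel
    rw [hX, hU, Matrix.mul_sub, sub_eq_zero.1 e2, ← Matrix.mul_assoc, h1, Matrix.add_mul,
      Matrix.mul_sub, Matrix.one_mul, Matrix.mul_assoc]
    abel
  have hY : IsUnit (1 + const P.C2 * X) := by
    have hXs : EntriesStrict X := by
      rw [hX, sub_eq_add_neg]
      exact hN.1.add (hR.1.mul_right (entriesProper_const H)).neg
    simpa using isUnit_one_sub_of_entriesStrict (hXs.mul_left (entriesProper_const P.C2)).neg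
  have hUK : U = K * (1 + const P.C2 * X) := by
    rw [hU, hX, ← hLK, ← hMK]
    simp only [Matrix.mul_add, Matrix.mul_sub, Matrix.mul_one, Matrix.mul_assoc]
    abel
  refine mem_Cstab_of_realization hD22 finSumFinEquiv
    (A := Matrix.fromBlocks (P.A + (P.B2 * F - P.B2 * Dq * P.C2 + H * P.C2)) (P.B2 * Cq)
      (-(Bq * P.C2)) Aq)
    (B := Matrix.fromRows (P.B2 * Dq - H) Bq)
    (C := Matrix.fromCols (F - Dq * P.C2) Cq) (D := Dq)
    -- The first gain feeds back `y = C₂ x̂`, which makes the innovation vanish; the second cancels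
    -- the `B₂ u` term of the observer. Both leave block triangular matrices with Schur diagonal
    -- blocks.
    (F := Matrix.fromCols P.C2 0) (H := Matrix.fromRows (-P.B2) 0)
    (Ξ := Matrix.fromRows X Ξq) (Y := 1 + const P.C2 * X) ?_ ?_ ?_ hY ?_ ?_
  · rw [Matrix.fromRows_mul_fromCols, Matrix.fromBlocks_add]
    convert! hF.fromBlocks_zero₂₁ hAq (P.B2 * Cq) using 2
    · rw [Matrix.sub_mul]
      abel
    · simp
    · simp
    · simp
  · rw [Matrix.fromRows_mul_fromCols, Matrix.fromBlocks_add]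
    convert! hH.fromBlocks_zero₁₂ hAq (-(Bq * P.C2)) using 2
    · simp only [Matrix.neg_mul, Matrix.mul_sub, Matrix.mul_assoc]
      abel
    · simp
    · simp
    · simp
  · rw [charTF_fromBlocks, Matrix.fromBlocks_mul_fromRows, Matrix.fromRows_map,
      Matrix.fromRows_mul, Matrix.fromRows_inj.eq_iff]
    refine ⟨?_, ?_⟩
    · rw [charTF_add, ← zIsub_eq, Matrix.sub_mul, hXeq, hUX]
      simp only [map_C_add, map_C_sub, map_C_mul, map_C_eq_const]
      simp only [Matrix.mul_add, Matrix.add_mul, Matrix.sub_mul, Matrix.neg_mul, Matrix.mul_one,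
        Matrix.mul_assoc]
      abel
    · rw [hΞq, map_C_neg, neg_neg, map_C_mul, Matrix.mul_add, Matrix.mul_one, ← Matrix.mul_assoc]
      simp only [map_C_eq_const]
      abel
  · rw [Matrix.fromCols_map, Matrix.fromCols_mul_fromRows, ← hUK, hUX, map_C_sub, map_C_mul]
    simp only [map_C_eq_const]
    rw [Matrix.sub_mul, Matrix.mul_add, Matrix.mul_one, ← Matrix.mul_assoc]
    abel
  · intro x ξ hx hξ
    -- Separation principle: in the coordinates `(x̂ - x, state of Q, x)` the closed loop is block
    -- lower triangular with diagonal blocks `A + H C₂`, `A_q`, `A + B₂ F`.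
    let T : Matrix ((Fin n ⊕ Fin q) ⊕ Fin n) ((Fin n ⊕ Fin q) ⊕ Fin n) ℝ :=
      Matrix.fromBlocks (Matrix.fromBlocks (P.A + H * P.C2) 0 (-(Bq * P.C2)) Aq) 0
        (Matrix.fromCols (P.B2 * F - P.B2 * Dq * P.C2) (P.B2 * Cq)) (P.A + P.B2 * F)
    have hT : SchurRoots T := (hH.fromBlocks_zero₁₂ hAq _).fromBlocks_zero₁₂ hF _
    have hrec := hT.tendsto_of_recursion
      (x := fun t => Sum.elim (Sum.elim (ξ t ∘ Sum.inl - x t) (ξ t ∘ Sum.inr)) (x t)) (by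
        intro t
        have h1 := congrArg (· ∘ Sum.inl) (hξ t)
        have h2 := congrArg (· ∘ Sum.inr) (hξ t)
        have h3 := hx t
        rw [Matrix.fromBlocks_mulVec, Matrix.fromRows_mulVec] at h1 h2
        rw [Matrix.fromCols_mulVec] at h3
        simp only [Pi.add_comp, Sum.elim_comp_inl, Sum.elim_comp_inr] at h1 h2
        simp only [T, Matrix.fromBlocks_mulVec, Matrix.fromCols_mulVec, Sum.elim_comp_inl,
          Sum.elim_comp_inr, h1, h2, h3]
        refine congrArg₂ Sum.elim ?_ ?_
        · simp only [Matrix.zero_mulVec, add_zero]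
          refine congrArg₂ Sum.elim ?_ ?_
          · simp only [Matrix.add_mulVec, Matrix.sub_mulVec, Matrix.mulVec_add, Matrix.mulVec_sub,
              Matrix.mulVec_mulVec, Matrix.mul_assoc, Matrix.sub_mul]
            abel
          · simp only [Matrix.neg_mulVec, Matrix.mulVec_sub, Matrix.mulVec_mulVec]
            abel
        · simp only [Matrix.add_mulVec, Matrix.sub_mulVec, Matrix.mulVec_add, Matrix.mulVec_sub,
            Matrix.mulVec_mulVec, Matrix.mul_assoc]
          abel)
    rw [tendsto_pi_nhds] at hrec
    have hxt (i : Fin n) : Tendsto (fun t => x t i) atTop (𝓝 0) := hrec (Sum.inr i)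
    refine ⟨tendsto_pi_nhds.2 hxt, tendsto_pi_nhds.2 ?_⟩
    rintro (i | i)
    · simpa using (hrec (Sum.inl (Sum.inl i))).add (hxt i)
    · exact hrec (Sum.inl (Sum.inr i))

end Plant

/-! ### The structured bijection. -/

namespace Plant

variable {n nw nu nz ny : ℕ} {P : Plant n nw nu nz ny}

theorem entriesProper_of_mem_Cstab {K : TF nu ny} (hK : K ∈ P.Cstab) : EntriesProper K := by
  obtain ⟨k, κ, -, -, rfl, -⟩ := hK
  exact entriesProper_transfer _ _ _ _

theorem entriesStrict_P22 (hD22 : P.D22 = 0) : EntriesStrict P.P22 := by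
  rw [P22_eq hD22]
  exact entriesStrict_strictTransfer _ _ _

theorem isUnit_one_sub_P22_mul (hD22 : P.D22 = 0) {K : TF nu ny} (hK : K ∈ P.Cstab) :
    IsUnit (1 - P.P22 * K) :=
  isUnit_one_sub_of_entriesStrict
    ((entriesStrict_P22 hD22).mul_right (entriesProper_of_mem_Cstab hK))

/-- The relation between `K` and `L` is symmetric up to the sign of `P₂₂`: `L = K + K P₂₂ L` and `K
= L + L (-P₂₂) K`. Quadratic invariance does not see this sign, so `mem_of_feedback` applies in both
directions. -/
theorem controller_mem_iff (hstab : IsStabilizable P.A P.B2) (hdet : IsDetectable P.A P.C2)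
    (hD22 : P.D22 = 0) {S : Submodule ℝ (TF nu ny)} (hclosed : IsClosedSubspace S)
    (hQI : QuadInvariant S P.P22) {θ : SLParam n nu ny} (h : θ ∈ P.slp) :
    θ.controller ∈ S ↔ θ.L ∈ S := by
  have hK := entriesProper_of_mem_Cstab (controller_mem_Cstab hstab hdet hD22 h)
  obtain ⟨R, M, N, L⟩ := θ
  have hfb := controller_feedback hD22 h
  have hL : EntriesProper L := (mem_RHinf_iff.1 (mem_slp_iff.1 h).2.2.2.2.2).1
  have hG := entriesStrict_P22 hD22
  change _ ↔ L ∈ S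
  refine ⟨mem_of_feedback hclosed hQI hG hK hL hfb, ?_⟩
  refine mem_of_feedback hclosed hQI.neg hG.neg hL hK ?_
  set K := SLParam.controller (R, M, N, L)
  have h1 : K + K * P.P22 * L = K * (1 + P.P22 * L) := by
    rw [Matrix.mul_add, Matrix.mul_one, Matrix.mul_assoc]
  have h2 : L * (1 - P.P22 * K) = K := by
    conv_lhs => rw [hfb, h1]
    rw [Matrix.mul_assoc, mul_eq_one_comm.1 (one_sub_mul_one_add hfb), Matrix.mul_one]
  conv_lhs => rw [← h2]
  rw [Matrix.mul_sub, Matrix.mul_one, Matrix.mul_neg, Matrix.neg_mul, ← Matrix.mul_assoc]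
  abel

theorem bijOn_controller (hstab : IsStabilizable P.A P.B2) (hdet : IsDetectable P.A P.C2)
    (hD22 : P.D22 = 0) {S : Submodule ℝ (TF nu ny)} (hclosed : IsClosedSubspace S)
    (hQI : QuadInvariant S P.P22) :
    Set.BijOn SLParam.controller (P.slpIn S) (P.Cstab ∩ (S : Set (TF nu ny))) := by
  refine ⟨fun θ h => ⟨controller_mem_Cstab hstab hdet hD22 h.1,
    (controller_mem_iff hstab hdet hD22 hclosed hQI h.1).2 h.2⟩,
    controller_injOn.mono fun θ h => h.1, ?_⟩
  rintro K ⟨hK, hKS⟩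
  obtain ⟨θ, hθ, rfl⟩ := exists_slp_of_mem_Cstab hD22 hK
  exact ⟨θ, ⟨hθ, (controller_mem_iff hstab hdet hD22 hclosed hQI hθ).1 hKS⟩, rfl⟩

end Plant

/-! ### Convexity of the SLP problem. -/

section Convexity

theorem real_smul_eq_C_smul {ι κ : Type*} (c : ℝ) (G : Matrix ι κ (RatFunc ℝ)) :
    c • G = RatFunc.C c • G := by
  ext i j
  simp [RatFunc.smul_eq_C_mul]

theorem EntriesIn.real_smul {ι κ : Type*} {T : Subring (RatFunc ℝ)}
    (hT : ∀ c : ℝ, RatFunc.C c ∈ T) (c : ℝ) {G : Matrix ι κ (RatFunc ℝ)} (hG : EntriesIn T G) :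
    EntriesIn T (c • G) := fun i j => by
  rw [real_smul_eq_C_smul]
  exact T.mul_mem (hT c) (hG i j)

theorem EntriesStrict.real_smul {ι κ : Type*} (c : ℝ) {G : Matrix ι κ (RatFunc ℝ)}
    (hG : EntriesStrict G) : EntriesStrict (c • G) := fun i j => by
  rw [real_smul_eq_C_smul, Matrix.smul_apply, smul_eq_mul, map_mul]
  exact (mul_le_of_le_one_left' (valInfty_C_le c)).trans_lt (hG i j)

theorem convex_RHinf (p m : ℕ) : Convex ℝ (RHinf p m) := by
  intro G hG H hH a b _ _ _
  rw [mem_RHinf_iff] at *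
  exact ⟨(hG.1.real_smul valInfty_C_le a).add (hH.1.real_smul valInfty_C_le b),
    (hG.2.real_smul C_mem_stableSubring a).add (hH.2.real_smul C_mem_stableSubring b)⟩

theorem real_smul_mem_RHinf {p m : ℕ} (c : ℝ) {G : TF p m} (hG : G ∈ RHinf p m) :
    c • G ∈ RHinf p m := by
  rw [mem_RHinf_iff] at *
  exact ⟨hG.1.real_smul valInfty_C_le c, hG.2.real_smul C_mem_stableSubring c⟩

theorem convex_sRHinf (p m : ℕ) : Convex ℝ (sRHinf p m) := by
  intro G hG H hH a b _ _ _
  rw [mem_sRHinf_iff] at *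
  exact ⟨(hG.1.real_smul a).add (hH.1.real_smul b),
    (hG.2.real_smul C_mem_stableSubring a).add (hH.2.real_smul C_mem_stableSubring b)⟩

namespace Plant

variable {n nw nu nz ny : ℕ} (P : Plant n nw nu nz ny)

theorem convex_slpIn (S : Submodule ℝ (TF nu ny)) : Convex ℝ (P.slpIn S) := by
  rintro ⟨R, M, N, L⟩ ⟨h, hS⟩ ⟨R', M', N', L'⟩ ⟨h', hS'⟩ a b ha hb hab
  refine ⟨?_, S.add_mem (S.smul_mem a hS) (S.smul_mem b hS')⟩
  obtain ⟨⟨e1, e2⟩, ⟨e3, e4⟩, hR, hM, hN, hL⟩ := mem_slp_iff.1 h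
  obtain ⟨⟨e1', e2'⟩, ⟨e3', e4'⟩, hR', hM', hN', hL'⟩ := mem_slp_iff.1 h'
  have hone : a • (1 : TF n n) + b • 1 = 1 := by rw [← add_smul, hab, one_smul]
  have hzero {p m : ℕ} : a • (0 : TF p m) + b • 0 = 0 := by rw [smul_zero, smul_zero, add_zero]
  simp only [Prod.smul_mk, Prod.mk_add_mk]
  refine mem_slp_iff.2 ⟨⟨?_, ?_⟩, ⟨?_, ?_⟩, convex_sRHinf _ _ hR hR' ha hb hab,
    convex_sRHinf _ _ hM hM' ha hb hab, convex_sRHinf _ _ hN hN' ha hb hab,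
    convex_RHinf _ _ hL hL' ha hb hab⟩
  · refine Eq.trans ?_ hone
    conv_rhs => lhs; rw [← e1]
    conv_rhs => rhs; rw [← e1']
    simp only [Matrix.mul_add, Matrix.mul_smul]
    module
  · refine Eq.trans ?_ hzero
    conv_rhs => lhs; rw [← e2]
    conv_rhs => rhs; rw [← e2']
    simp only [Matrix.mul_add, Matrix.mul_smul]
    module
  · refine Eq.trans ?_ hone
    conv_rhs => lhs; rw [← e3]
    conv_rhs => rhs; rw [← e3']
    simp only [Matrix.add_mul, Matrix.smul_mul]
    module
  · refine Eq.trans ?_ hzero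
    conv_rhs => lhs; rw [← e4]
    conv_rhs => rhs; rw [← e4']
    simp only [Matrix.add_mul, Matrix.smul_mul]
    module

/-- The response is affine rather than linear; `a + b = 1` is what splits the constant term `D₁₁`.
-/
theorem slpResponse_convexComb (θ θ' : SLParam n nu ny) {a b : ℝ} (hab : a + b = 1) :
    P.slpResponse (a • θ + b • θ') = a • P.slpResponse θ + b • P.slpResponse θ' := by
  have hD : const P.D11 = a • const P.D11 + b • const P.D11 := by
    rw [← add_smul, hab, one_smul]
  have hblock : (a • θ + b • θ').block = a • θ.block + b • θ'.block := by
    simp [SLParam.block, SLParam.R, SLParam.M, SLParam.N, SLParam.L, Matrix.fromBlocks_smul,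
      Matrix.fromBlocks_add]
  rw [slpResponse, hblock, hD, slpResponse, slpResponse]
  simp only [Matrix.mul_add, Matrix.add_mul, Matrix.mul_smul, Matrix.smul_mul, smul_add]
  abel

theorem convexOn_slpResponse (S : Submodule ℝ (TF nu ny)) {ν : TF nz nw → ℝ}
    (hν : IsSeminormOnRHinf ν) : ConvexOn ℝ (P.slpIn S) (fun θ => ν (P.slpResponse θ)) := by
  refine ⟨P.convex_slpIn S, fun θ h θ' h' a b ha hb hab => ?_⟩
  have hθ := slpResponse_mem_RHinf h.1
  have hθ' := slpResponse_mem_RHinf h'.1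
  beta_reduce
  rw [slpResponse_convexComb P θ θ' hab]
  refine (hν.1 _ (real_smul_mem_RHinf a hθ) _ (real_smul_mem_RHinf b hθ')).trans_eq ?_
  rw [hν.2 a _ hθ, hν.2 b _ hθ', abs_of_nonneg ha, abs_of_nonneg hb, smul_eq_mul, smul_eq_mul]

end Plant

end Convexity

end OutputFeedback

end

/-- The optimal values are infima in `EReal`, so that an infeasible problem has value `⊤`; in `ℝ`
the bounded infimum would pick up the default value `0` from indices outside the feasible set. -/
theorem corollary2 {n nw nu nz ny : ℕ} (P : OutputFeedback.Plant n nw nu nz ny)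
    (hstab : OutputFeedback.IsStabilizable P.A P.B2)
    (hdet : OutputFeedback.IsDetectable P.A P.C2)
    (hD22 : P.D22 = 0)
    (S : Submodule ℝ (OutputFeedback.TF nu ny))
    (hclosed : OutputFeedback.IsClosedSubspace S)
    (hQI : OutputFeedback.QuadInvariant S P.P22) :
    -- the inverses in `f(P, K)` and in `L - M R⁻¹ N` exist
    (∀ K ∈ P.Cstab, IsUnit (1 - P.P22 * K)) ∧
    (∀ θ ∈ P.slp, IsUnit (OutputFeedback.SLParam.R θ)) ∧
    -- the set of structured stabilizing controllers
    P.Cstab ∩ (S : Set (OutputFeedback.TF nu ny)) =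
      {K | ∃ (R : OutputFeedback.TF n n) (M : OutputFeedback.TF nu n)
        (N : OutputFeedback.TF n ny) (L : OutputFeedback.TF nu ny),
        (R, M, N, L) ∈ P.slp ∧ L ∈ S ∧ K = L - M * R⁻¹ * N} ∧
    -- the change of variables is one-to-one and carries one objective into the other
    Set.BijOn OutputFeedback.SLParam.controller (P.slpIn S)
      (P.Cstab ∩ (S : Set (OutputFeedback.TF nu ny))) ∧
    (∀ θ ∈ P.slpIn S,
      P.closedLoop (OutputFeedback.SLParam.controller θ) = P.slpResponse θ ∧
      P.slpResponse θ ∈ OutputFeedback.RHinf nz nw) ∧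
    -- for every norm the two problems are equivalent and the second one is convex
    ∀ ν : OutputFeedback.TF nz nw → ℝ, OutputFeedback.IsSeminormOnRHinf ν →
      ConvexOn ℝ (P.slpIn S) (fun θ => ν (P.slpResponse θ)) ∧
      (⨅ K ∈ P.Cstab ∩ (S : Set (OutputFeedback.TF nu ny)),
          ((ν (P.closedLoop K) : ℝ) : EReal)) =
        (⨅ θ ∈ P.slpIn S, ((ν (P.slpResponse θ) : ℝ) : EReal)) ∧
      (∀ θ ∈ P.slpIn S,
        (IsMinOn (fun θ' => ν (P.slpResponse θ')) (P.slpIn S) θ ↔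
          IsMinOn (fun K => ν (P.closedLoop K))
            (P.Cstab ∩ (S : Set (OutputFeedback.TF nu ny)))
            (OutputFeedback.SLParam.controller θ))) := by
  have hbij := OutputFeedback.Plant.bijOn_controller hstab hdet hD22 hclosed hQI
  have hcl : ∀ θ ∈ P.slpIn S,
      P.closedLoop (OutputFeedback.SLParam.controller θ) = P.slpResponse θ := fun θ h =>
    OutputFeedback.Plant.closedLoop_controller hD22 h.1
  refine ⟨fun K hK => OutputFeedback.Plant.isUnit_one_sub_P22_mul hD22 hK, ?_, ?_, hbij,
    fun θ h => ⟨hcl θ h, OutputFeedback.Plant.slpResponse_mem_RHinf h.1⟩, fun ν hν =>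
    ⟨P.convexOn_slpResponse S hν, ?_, fun θ hθ => ?_⟩⟩
  · rintro ⟨R, M, N, L⟩ h
    exact OutputFeedback.Plant.isUnit_R_of_mem_slp h
  · rw [← hbij.image_eq]
    ext K
    constructor
    · rintro ⟨⟨R, M, N, L⟩, h, rfl⟩
      exact ⟨R, M, N, L, h.1, h.2, rfl⟩
    · rintro ⟨R, M, N, L, h, hS, rfl⟩
      exact ⟨(R, M, N, L), ⟨h, hS⟩, rfl⟩
  · rw [← hbij.image_eq, iInf_image]
    exact iInf_congr fun θ => iInf_congr fun h => by rw [hcl θ h]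
  · rw [← hbij.image_eq, isMinOn_iff, isMinOn_iff, Set.forall_mem_image, hcl θ hθ]
    exact forall₂_congr fun θ' h' => by rw [hcl θ' h']
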